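/- Let $q:\mathbb R\to\mathbb R$ be locally integrable and even, $q(-x)=q(x)$, and let $\tau_q(y)=-y''-qy$ be in the limit circle case at $+\infty$ and at $-\infty$, i.e. for every $\lambda\in\mathbb C$ every solution $y$ of $\tau_q(y)=\lambda y$ (with $y,y'\in AC_{loc}(\mathbb R)$) is square integrable near $+\infty$ and near $-\infty$. Let $\mathcal D_{\max}=\{y\in L^2(\mathbb R): y,y'\in AC_{loc}(\mathbb R),\ \tau_q(y)\in L^2(\mathbb R)\}$, let $A_{\max}y=\tau_q(y)$ on $\mathcal D_{\max}$, and let $A$ (the minimal operator) be the closure of the restriction of $A_{\max}$ to the functions in $\mathcal D_{\max}$ with compact support. A closed operator $\widetilde A$ in $L^2(\mathbb R)$ with $A\subset\widetilde A\subset A^*$ and $\dim(\operatorname{dom}\widetilde A/\operatorname{dom}A)=3$ is called a $3$-dimensional bi-extension of $A$. Put $[f,g]_x=\overline{f(x)}g'(x)-\overline{f'(x)}g(x)$ and $[f,g]_{\pm\infty}=\lim_{x\to\pm\infty}[f,g]_x$ for $f,g\in\mathcal D_{\max}$. (1) There are real-valued solutions $w_1,w_2\in\mathcal D_{\max}$ of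 $\tau_q(y)=0$ with $w_1$ odd, $w_2$ even, $[w_1,w_2]_{\pm\infty}=1$ and $[w_1,w_1]_{\pm\infty}=[w_2,w_2]_{\pm\infty}=0$. (2) For any such $w_1,w_2$ put $\alpha_j(f)=[w_j,f]_{-\infty}$ and $\beta_j(f)=[w_j,f]_{\infty}$, $j=1,2$. An operator $\widetilde A$ in $L^2(\mathbb R)$ is a $3$-dimensional bi-extension of $A$ if and only if it is the restriction of $A_{\max}$ to a domain of the form $$\{f\in\mathcal D_{\max}:\ a\,\alpha_1(f)+b\,\alpha_2(f)=c\,\beta_1(f)+d\,\beta_2(f)\}$$ with $a,b,c,d\in\mathbb C$ not all zero. For every $3$-dimensional bi-extension $\widetilde A$ of $A$, every $\lambda\in\mathbb C\setminus\mathbb R$ is an eigenvalue of $\widetilde A$, and $\sigma(\widetilde A)=\mathbb C$. (3) In particular, there is a $3$-dimensional bi-extension $\widetilde A$ of $A$ with empty resolvent set which is $\mathcal{PT}$ symmetric, i.e. (being closed and densely defined) for all $f\in\operatorname{dom}\widetilde A$ it satisfies $\mathcal{PT}f\in\operatorname{dom}\widetilde A$ and $\mathcal{PT}\widetilde Af=\widetilde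 A\,\mathcal{PT}f$, where $(\mathcal{PT}f)(x)=\overline{f(-x)}$. -/

import Mathlib

open MeasureTheory Filter Topology Set
open scoped ComplexConjugate ENNReal

noncomputable section

namespace SturmLiouville

/-- The Hilbert space `L²(ℝ)` of complex-valued functions. -/
abbrev L2 : Type := Lp ℂ 2 (volume : Measure ℝ)

/-- `AC_loc(ℝ)`: absolutely continuous on every compact interval. -/
def ACLoc (y : ℝ → ℂ) : Prop := ∀ a b : ℝ, AbsolutelyContinuousOnInterval y a b

/-- `y` is differentiable and both `y` and `y'` belong to `AC_loc(ℝ)`. -/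
structure IsRegular (y : ℝ → ℂ) : Prop where
  differentiable : Differentiable ℝ y
  acLoc : ACLoc y
  acLoc_deriv : ACLoc (deriv y)

/-- The differential expression `τ_q y = -y'' - q y`; for regular `y` the second derivative
exists almost everywhere. -/
def tau (q : ℝ → ℝ) (y : ℝ → ℂ) : ℝ → ℂ := fun x => -deriv (deriv y) x - (q x : ℂ) * y x

/-- `y` solves `τ_q y = l y` (in the Carathéodory sense). -/
def IsSolution (q : ℝ → ℝ) (l : ℂ) (y : ℝ → ℂ) : Prop :=
  IsRegular y ∧ ∀ᵐ x : ℝ, tau q y x = l * y x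

/-- Limit circle case at `+∞`: all solutions of `τ_q y = l y`, `l ∈ ℂ`, are square integrable
near `+∞`. -/
def LimitCircleAtTop (q : ℝ → ℝ) : Prop :=
  ∀ (l : ℂ) (y : ℝ → ℂ), IsSolution q l y → ∃ a : ℝ, MemLp y 2 (volume.restrict (Ioi a))

/-- Limit circle case at `-∞`: all solutions of `τ_q y = l y`, `l ∈ ℂ`, are square integrable
near `-∞`. -/
def LimitCircleAtBot (q : ℝ → ℝ) : Prop :=
  ∀ (l : ℂ) (y : ℝ → ℂ), IsSolution q l y → ∃ a : ℝ, MemLp y 2 (volume.restrict (Iio a))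

theorem ACLoc.ae_differentiableAt {y : ℝ → ℂ} (h : ACLoc y) :
    ∀ᵐ x : ℝ, DifferentiableAt ℝ y x := by
  have hv : LocallyBoundedVariationOn y univ := by
    intro a b _ _
    rw [univ_inter]
    rcases le_total a b with hab | hab
    · simpa [uIcc_of_le hab] using (h a b).boundedVariationOn
    · have hs : (Icc a b).Subsingleton := by
        intro u hu v hv
        linarith [hu.1, hu.2, hv.1, hv.2, le_antisymm (hu.1.trans hu.2) hab,
          le_antisymm (hv.1.trans hv.2) hab]
      simp [BoundedVariationOn, eVariationOn.subsingleton _ hs]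
  exact hv.ae_differentiableAt

theorem IsRegular.zero : IsRegular 0 := by
  have h0 : ACLoc (fun _ => (0 : ℂ)) := fun a b =>
    contDiffOn_const.absolutelyContinuousOnInterval
  refine ⟨differentiable_const _, h0, ?_⟩
  have : deriv (0 : ℝ → ℂ) = fun _ => 0 := by ext x; simp
  rw [this]; exact h0

theorem IsRegular.add {y z : ℝ → ℂ} (hy : IsRegular y) (hz : IsRegular z) :
    IsRegular (y + z) := by
  have hd : deriv (y + z) = deriv y + deriv z := by
    ext x; exact deriv_add (hy.differentiable x) (hz.differentiable x)
  refine ⟨hy.differentiable.add hz.differentiable, fun a b => (hy.acLoc a b).add (hz.acLoc a b), ?_⟩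
  rw [hd]
  exact fun a b => (hy.acLoc_deriv a b).add (hz.acLoc_deriv a b)

theorem IsRegular.smul {y : ℝ → ℂ} (c : ℂ) (hy : IsRegular y) : IsRegular (c • y) := by
  have hd : deriv (c • y) = c • deriv y := by
    ext x; exact deriv_const_smul c (hy.differentiable x)
  refine ⟨hy.differentiable.const_smul c, fun a b => (hy.acLoc a b).const_smul c, ?_⟩
  rw [hd]
  exact fun a b => (hy.acLoc_deriv a b).const_smul c

theorem tau_add (q : ℝ → ℝ) {y z : ℝ → ℂ} (hy : IsRegular y) (hz : IsRegular z) :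
    tau q (y + z) =ᵐ[volume] tau q y + tau q z := by
  have hd : deriv (y + z) = deriv y + deriv z := by
    ext x; exact deriv_add (hy.differentiable x) (hz.differentiable x)
  filter_upwards [hy.acLoc_deriv.ae_differentiableAt, hz.acLoc_deriv.ae_differentiableAt]
    with x h1 h2
  simp only [tau, hd, Pi.add_apply, deriv_add h1 h2]
  ring

theorem tau_smul (q : ℝ → ℝ) (c : ℂ) {y : ℝ → ℂ} (hy : IsRegular y) :
    tau q (c • y) =ᵐ[volume] c • tau q y := by
  have hd : deriv (c • y) = c • deriv y := by
    ext x; exact deriv_const_smul c (hy.differentiable x)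
  filter_upwards [hy.acLoc_deriv.ae_differentiableAt] with x h1
  simp only [tau, hd, Pi.smul_apply, deriv_const_smul c h1, smul_eq_mul]
  ring

/-- The maximal domain `D_max`, as a space of (regular) functions. -/
def maxDomain (q : ℝ → ℝ) : Submodule ℂ (ℝ → ℂ) where
  carrier := {y | IsRegular y ∧ MemLp y 2 volume ∧ MemLp (tau q y) 2 volume}
  zero_mem' := by
    refine ⟨IsRegular.zero, MemLp.zero, ?_⟩
    have h0 : tau q 0 = 0 := by
      have : deriv (0 : ℝ → ℂ) = 0 := by ext x; simp
      ext x; simp [tau, this]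
    rw [h0]; exact MemLp.zero
  add_mem' := fun {y z} hy hz =>
    ⟨hy.1.add hz.1, hy.2.1.add hz.2.1,
      (memLp_congr_ae (tau_add q hy.1 hz.1)).2 (hy.2.2.add hz.2.2)⟩
  smul_mem' := fun c y hy =>
    ⟨hy.1.smul c, hy.2.1.const_smul c,
      (memLp_congr_ae (tau_smul q c hy.1)).2 (hy.2.2.const_smul c)⟩

/-- The class in `L²(ℝ)` of a function of the maximal domain. -/
def toL2 (q : ℝ → ℝ) : maxDomain q →ₗ[ℂ] L2 where
  toFun y := MemLp.toLp (y : ℝ → ℂ) y.2.2.1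
  map_add' _ _ := rfl
  map_smul' _ _ := rfl

/-- The class of `τ_q y` in `L²(ℝ)`, for `y` in the maximal domain. -/
def tauL2 (q : ℝ → ℝ) : maxDomain q →ₗ[ℂ] L2 where
  toFun y := MemLp.toLp (tau q y) y.2.2.2
  map_add' y z := by
    rw [← MemLp.toLp_add]
    exact (MemLp.toLp_eq_toLp_iff _ _).2 (tau_add q y.2.1 z.2.1)
  map_smul' c y := by
    rw [RingHom.id_apply, ← MemLp.toLp_const_smul]
    exact (MemLp.toLp_eq_toLp_iff _ _).2 (tau_smul q c y.2.1)

theorem toL2_injective (q : ℝ → ℝ) : Function.Injective (toL2 q) := by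
  intro y z h
  have h' : (y : ℝ → ℂ) =ᵐ[volume] (z : ℝ → ℂ) := (MemLp.toLp_eq_toLp_iff y.2.2.1 z.2.2.1).1 h
  exact Subtype.ext (Continuous.ae_eq_iff_eq volume y.2.1.differentiable.continuous
    z.2.1.differentiable.continuous |>.1 h')

/-- The maximal operator `A_max` in `L²(ℝ)`: it sends the class of `y ∈ D_max` to that of
`τ_q y`. -/
def maxOp (q : ℝ → ℝ) : L2 →ₗ.[ℂ] L2 where
  domain := LinearMap.range (toL2 q)
  toFun := tauL2 q ∘ₗ (LinearEquiv.ofInjective (toL2 q) (toL2_injective q)).symm.toLinearMap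

/-- The functions of the maximal domain that have compact support. -/
def compactDomain (q : ℝ → ℝ) : Submodule ℂ (maxDomain q) where
  carrier := {y | HasCompactSupport (y : ℝ → ℂ)}
  zero_mem' := HasCompactSupport.zero
  add_mem' := fun hy hz => HasCompactSupport.add hy hz
  smul_mem' := fun c _ hy => HasCompactSupport.smul_left (f := fun _ => c) hy

/-- The pre-minimal operator `A₀`. -/
def preMinOp (q : ℝ → ℝ) : L2 →ₗ.[ℂ] L2 :=
  (maxOp q).domRestrict ((compactDomain q).map (toL2 q))

/-- The minimal operator `A`, the closure of `A₀`. -/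
def minOp (q : ℝ → ℝ) : L2 →ₗ.[ℂ] L2 := (preMinOp q).closure

/-- `T` is an `r`-dimensional bi-extension of `A`: a closed operator with `A ⊆ T ⊆ A*` and
`dim (dom T / dom A) = r`. -/
def IsBiExtension (A T : L2 →ₗ.[ℂ] L2) (r : ℕ) : Prop :=
  T.IsClosed ∧ A ≤ T ∧ T ≤ A.adjoint ∧
    Module.rank ℂ (T.domain ⧸ A.domain.submoduleOf T.domain) = (r : Cardinal)

/-- The bracket `[f,g]_x = conj (f x) g'(x) - conj (f' x) g(x)`. -/
def bracket (f g : ℝ → ℂ) (x : ℝ) : ℂ := conj (f x) * deriv g x - conj (deriv f x) * g x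

/-- `[f,g]_∞`; the limit exists for `f`, `g` in the maximal domain. -/
def bracketTop (f g : ℝ → ℂ) : ℂ := limUnder atTop (bracket f g)

/-- `[f,g]_{-∞}`; the limit exists for `f`, `g` in the maximal domain. -/
def bracketBot (f g : ℝ → ℂ) : ℂ := limUnder atBot (bracket f g)

/-- `w₁`, `w₂` are real-valued solutions of `τ_q y = 0` in the maximal domain, `w₁` odd and `w₂`
even, with `[w₁,w₂]_{±∞} = 1` and `[w₁,w₁]_{±∞} = [w₂,w₂]_{±∞} = 0`. -/
structure IsBoundaryPair (q : ℝ → ℝ) (w₁ w₂ : ℝ → ℂ) : Prop where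
  mem₁ : w₁ ∈ maxDomain q
  mem₂ : w₂ ∈ maxDomain q
  sol₁ : IsSolution q 0 w₁
  sol₂ : IsSolution q 0 w₂
  real₁ : ∀ x, (w₁ x).im = 0
  real₂ : ∀ x, (w₂ x).im = 0
  odd₁ : ∀ x, w₁ (-x) = -w₁ x
  even₂ : ∀ x, w₂ (-x) = w₂ x
  bot₁₂ : Tendsto (bracket w₁ w₂) atBot (𝓝 1)
  top₁₂ : Tendsto (bracket w₁ w₂) atTop (𝓝 1)
  bot₁₁ : Tendsto (bracket w₁ w₁) atBot (𝓝 0)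
  top₁₁ : Tendsto (bracket w₁ w₁) atTop (𝓝 0)
  bot₂₂ : Tendsto (bracket w₂ w₂) atBot (𝓝 0)
  top₂₂ : Tendsto (bracket w₂ w₂) atTop (𝓝 0)

/-- `T` is the restriction of `A_max` to the domain
`{f ∈ D_max : a α₁(f) + b α₂(f) = c β₁(f) + d β₂(f)}`, where `α_j(f) = [w_j,f]_{-∞}` and
`β_j(f) = [w_j,f]_∞`. -/
def HasBoundaryCondition (q : ℝ → ℝ) (w₁ w₂ : ℝ → ℂ) (a b c d : ℂ) (T : L2 →ₗ.[ℂ] L2) : Prop :=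
  T ≤ maxOp q ∧
    ∀ f : L2, f ∈ T.domain ↔ ∃ y : maxDomain q, toL2 q y = f ∧
      a * bracketBot w₁ y + b * bracketBot w₂ y = c * bracketTop w₁ y + d * bracketTop w₂ y

/-- The parity operator `(P f)(x) = f(-x)`. -/
def parity (f : L2) : L2 :=
  Lp.compMeasurePreserving Neg.neg (Measure.measurePreserving_neg (volume : Measure ℝ)) f

/-- The time reversal operator `(T f)(x) = conj (f x)`. -/
def timeReversal (f : L2) : L2 := star f

/-- The closed densely defined operator `T` is `PT` symmetric. -/
def IsPTSymmetric (T : L2 →ₗ.[ℂ] L2) : Prop :=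
  T.IsClosed ∧ Dense (T.domain : Set L2) ∧
    ∀ f : T.domain, ∃ h : parity (timeReversal f) ∈ T.domain,
      parity (timeReversal (T f)) = T ⟨parity (timeReversal f), h⟩

/-- `l` is an eigenvalue of `T`. -/
def IsEigenvalue (T : L2 →ₗ.[ℂ] L2) (l : ℂ) : Prop :=
  ∃ f : T.domain, (f : L2) ≠ 0 ∧ T f = l • (f : L2)

/-- The resolvent set of `T`: those `l` for which `T - l : dom T → L²(ℝ)` is a bijection with
bounded inverse `R`. -/
def resolventSet (T : L2 →ₗ.[ℂ] L2) : Set ℂ :=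
  {l | ∃ R : L2 →L[ℂ] L2,
    (∀ g : L2, ∃ h : R g ∈ T.domain, T ⟨R g, h⟩ - l • R g = g) ∧
    ∀ f : T.domain, R (T f - l • (f : L2)) = f}

/-- The spectrum of `T`. -/
def spectrumOf (T : L2 →ₗ.[ℂ] L2) : Set ℂ := (resolventSet T)ᶜ

end SturmLiouville

end

noncomputable section

namespace SturmLiouville

/-! The theorem reduces to linear algebra in the space `ℂ⁴` of boundary values `(α₁, α₂, β₁, β₂)`.
Green's formula (`bracketTop_sub_bracketBot`) writes `⟨A_max f, g⟩ - ⟨f, A_max g⟩` as a difference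
of brackets at `±∞`. Variation of constants and a du Bois-Reymond argument
(`exists_maxDomain_of_forall_inner_eq`) give `A₀* = A_max`, hence `A* = A_max` and `A = A_max*`. So
`dom A` consists of those `y` whose brackets with every `z` agree at both ends. Cutting `z` off near
one end, together with the Plücker identity `bracket_plucker`, turns this into the vanishing of the
four boundary values.

The boundary map is onto `ℂ⁴` with kernel `dom A`, so the operators between `A` and `A_max`
correspond to subspaces of `ℂ⁴`. Three-dimensional ones are hyperplanes, that is, kernels of nonzero
functionals (`isBiExtension_iff`); closedness is automatic because boundary values are continuous in
the graph norm.

In the limit circle case every solution of `τ_q y = l y` lies in `D_max`. One linear condition on a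
two-dimensional space has a nonzero solution, so every `l` is an eigenvalue and the resolvent set is
empty. Finally, `PT` sends `(α₁, β₁)` to `(conj β₁, conj α₁)`, so the condition `α₁ = β₁` is `PT`
invariant. -/

/-! ### Calculus of locally absolutely continuous functions. -/

theorem absolutelyContinuousOnInterval_of_dist_le {X Y : Type*} [PseudoMetricSpace X]
    [PseudoMetricSpace Y] {f : ℝ → X} {g : ℝ → Y} {a b : ℝ} (K : ℝ)
    (hf : AbsolutelyContinuousOnInterval f a b)
    (h : ∀ x ∈ uIcc a b, ∀ y ∈ uIcc a b, dist (g x) (g y) ≤ K * dist (f x) (f y)) :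
    AbsolutelyContinuousOnInterval g a b := by
  have h0 := Tendsto.const_mul K hf
  rw [mul_zero] at h0
  refine squeeze_zero' (Eventually.of_forall fun _ => Finset.sum_nonneg fun _ _ => dist_nonneg)
    ?_ h0
  rw [eventually_inf_principal]
  filter_upwards with E hE
  rw [Finset.mul_sum]
  exact Finset.sum_le_sum fun i hi => h _ (hE.1 i hi).1 _ (hE.1 i hi).2

theorem ACLoc.continuous {y : ℝ → ℂ} (h : ACLoc y) : Continuous y := by
  rw [continuous_iff_continuousAt]
  intro x
  refine (h (x - 1) (x + 1)).continuousOn.continuousAt ?_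
  rw [uIcc_of_le (by linarith)]
  exact Icc_mem_nhds (by linarith) (by linarith)

theorem ACLoc.const (c : ℂ) : ACLoc fun _ => c := fun _ _ =>
  contDiffOn_const.absolutelyContinuousOnInterval

theorem ACLoc.add {f g : ℝ → ℂ} (hf : ACLoc f) (hg : ACLoc g) : ACLoc fun x => f x + g x :=
  fun a b => (hf a b).fun_add (hg a b)

theorem ACLoc.sub {f g : ℝ → ℂ} (hf : ACLoc f) (hg : ACLoc g) : ACLoc fun x => f x - g x :=
  fun a b => (hf a b).fun_sub (hg a b)

theorem ACLoc.neg {f : ℝ → ℂ} (hf : ACLoc f) : ACLoc fun x => -f x :=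
  fun a b => (hf a b).fun_neg

theorem ACLoc.mul {f g : ℝ → ℂ} (hf : ACLoc f) (hg : ACLoc g) : ACLoc fun x => f x * g x :=
  fun a b => (hf a b).fun_smul (hg a b)

theorem ACLoc.conj {f : ℝ → ℂ} (hf : ACLoc f) : ACLoc fun x => conj (f x) := fun a b =>
  absolutelyContinuousOnInterval_of_dist_le 1 (hf a b) fun x _ y _ => by
    rw [one_mul, Complex.dist_conj_conj]

theorem ACLoc.of_hasDerivAt {y v : ℝ → ℂ} (hy : ∀ x, HasDerivAt y (v x) x) (hv : Continuous v) :
    ACLoc y := fun _ _ => by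
  have hd : deriv y = v := funext fun x => (hy x).deriv
  have : ContDiff ℝ 1 y :=
    contDiff_one_iff_deriv.2 ⟨fun x => (hy x).differentiableAt, hd ▸ hv⟩
  exact this.contDiffOn.absolutelyContinuousOnInterval

theorem IsRegular.of_hasDerivAt {y v : ℝ → ℂ} (hy : ∀ x, HasDerivAt y (v x) x) (hv : ACLoc v) :
    IsRegular y :=
  ⟨fun x => (hy x).differentiableAt, ACLoc.of_hasDerivAt hy hv.continuous,
    (funext fun x => (hy x).deriv : deriv y = v) ▸ hv⟩

theorem locallyIntegrable_intervalIntegrable {E : Type*} [NormedAddCommGroup E] {f : ℝ → E}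
    (hf : LocallyIntegrable f volume) (a b : ℝ) : IntervalIntegrable f volume a b :=
  intervalIntegrable_iff.mpr
    ((hf.integrableOn_isCompact isCompact_uIcc).mono_set uIoc_subset_uIcc)

theorem absolutelyContinuousOnInterval_integral {E : Type*} [NormedAddCommGroup E]
    [NormedSpace ℝ E] {f : ℝ → E} (hf : LocallyIntegrable f volume) (c a b : ℝ) :
    AbsolutelyContinuousOnInterval (fun x => ∫ t in c..x, f t) a b := by
  have hi := locallyIntegrable_intervalIntegrable hf
  -- Only increments matter, so the primitive of `f` from `c` may be compared with the scalar
  -- primitive of `‖f‖` from `a`.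
  refine absolutelyContinuousOnInterval_of_dist_le 1
    ((hi a b).norm.absolutelyContinuousOnInterval_intervalIntegral left_mem_uIcc) ?_
  intro x _ y _
  rw [one_mul, dist_eq_norm, dist_eq_norm,
    intervalIntegral.integral_interval_sub_left (hi _ _) (hi _ _),
    intervalIntegral.integral_interval_sub_left (hi _ _).norm (hi _ _).norm]
  exact intervalIntegral.norm_integral_le_abs_integral_norm

theorem acLoc_integral {f : ℝ → ℂ} (hf : LocallyIntegrable f volume) (c : ℝ) :
    ACLoc fun x => ∫ t in c..x, f t :=
  fun a b => absolutelyContinuousOnInterval_integral hf c a b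

theorem locallyIntegrable_of_intervalIntegrable {E : Type*} [NormedAddCommGroup E] {f : ℝ → E}
    (h : ∀ a b, IntervalIntegrable f volume a b) : LocallyIntegrable f volume := by
  intro x
  refine ⟨Ioc (x - 1) (x + 1), Ioc_mem_nhds (by linarith) (by linarith), ?_⟩
  exact (intervalIntegrable_iff_integrableOn_Ioc_of_le (by linarith)).1 (h _ _)

theorem ACLoc.locallyIntegrable_deriv {f : ℝ → ℂ} (hf : ACLoc f) :
    LocallyIntegrable (deriv f) volume := by
  refine locallyIntegrable_of_intervalIntegrable fun a b => ?_
  have hre : AbsolutelyContinuousOnInterval (fun x => (f x).re) a b :=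
    absolutelyContinuousOnInterval_of_dist_le 1 (hf a b) fun x _ y _ => by
      rw [one_mul, Real.dist_eq, dist_eq_norm, ← Complex.sub_re]
      exact Complex.abs_re_le_norm _
  have him : AbsolutelyContinuousOnInterval (fun x => (f x).im) a b :=
    absolutelyContinuousOnInterval_of_dist_le 1 (hf a b) fun x _ y _ => by
      rw [one_mul, Real.dist_eq, dist_eq_norm, ← Complex.sub_im]
      exact Complex.abs_im_le_norm _
  have ofReal {g : ℝ → ℝ} (hg : IntervalIntegrable g volume a b) :
      IntervalIntegrable (fun x => (g x : ℂ)) volume a b := ⟨hg.1.ofReal, hg.2.ofReal⟩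
  have h1 : IntervalIntegrable (fun x => ((deriv (fun x => (f x).re) x : ℝ) : ℂ)
      + (deriv (fun x => (f x).im) x : ℝ) * Complex.I) volume a b :=
    IntervalIntegrable.add (ofReal hre.intervalIntegrable_deriv)
      (IntervalIntegrable.mul_const (ofReal him.intervalIntegrable_deriv) _)
  refine h1.congr_ae (ae_restrict_of_ae ?_)
  filter_upwards [hf.ae_differentiableAt] with x hx
  have e1 : HasDerivAt (fun x => (f x).re) (deriv f x).re x :=
    Complex.reCLM.hasFDerivAt.comp_hasDerivAt x hx.hasDerivAt
  have e2 : HasDerivAt (fun x => (f x).im) (deriv f x).im x :=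
    Complex.imCLM.hasFDerivAt.comp_hasDerivAt x hx.hasDerivAt
  rw [e1.deriv, e2.deriv, Complex.re_add_im]

/-- `F` minus the primitive of `f` is absolutely continuous with derivative zero almost everywhere,
hence constant. -/
theorem integral_eq_sub_of_ae_hasDerivAt {E : Type*} [NormedAddCommGroup E] [NormedSpace ℝ E]
    [CompleteSpace E] {F f : ℝ → E} (hF : ∀ a b, AbsolutelyContinuousOnInterval F a b)
    (hf : LocallyIntegrable f volume) (hd : ∀ᵐ x : ℝ, HasDerivAt F (f x) x) (a b : ℝ) :
    ∫ x in a..b, f x = F b - F a := by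
  have hac : AbsolutelyContinuousOnInterval (fun x => F x - ∫ t in a..x, f t) a b :=
    (hF a b).fun_sub (absolutelyContinuousOnInterval_integral hf a a b)
  obtain ⟨C, hC⟩ := hac.const_of_ae_hasDerivAt_zero (by
    filter_upwards [hd, LocallyIntegrable.ae_hasDerivAt_integral hf] with x h1 h2 _
    simpa using h1.fun_sub (h2 a))
  have h1 := hC a left_mem_uIcc
  have h2 := hC b right_mem_uIcc
  simp only [intervalIntegral.integral_same, sub_zero] at h1
  rw [h1, ← h2]
  abel

theorem ACLoc.integral_eq_sub {F f : ℝ → ℂ} (hF : ACLoc F)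
    (hd : ∀ᵐ x : ℝ, HasDerivAt F (f x) x) (a b : ℝ) :
    IntervalIntegrable f volume a b ∧ ∫ x in a..b, f x = F b - F a := by
  have h : deriv F =ᵐ[volume] f := by
    filter_upwards [hd] with x hx using hx.deriv
  have hf : LocallyIntegrable f volume := hF.locallyIntegrable_deriv.congr h
  exact ⟨locallyIntegrable_intervalIntegrable hf a b,
    integral_eq_sub_of_ae_hasDerivAt hF hf hd a b⟩

/-- `F` is a primitive of the continuous `f`, so the almost everywhere derivative is one everywhere.
Variation of constants needs this upgrade. -/
theorem ACLoc.hasDerivAt_of_continuous {F f : ℝ → ℂ} (hF : ACLoc F)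
    (hd : ∀ᵐ x : ℝ, HasDerivAt F (f x) x) (hf : Continuous f) (x : ℝ) : HasDerivAt F (f x) x := by
  have h : F = fun x => F 0 + ∫ t in (0 : ℝ)..x, f t := by
    ext x
    rw [(hF.integral_eq_sub hd 0 x).2]
    ring
  rw [h]
  exact (intervalIntegral.integral_hasDerivAt_right (hf.intervalIntegrable _ _)
    (hf.stronglyMeasurableAtFilter _ _) hf.continuousAt).const_add _

theorem ACLoc.comp_neg {f : ℝ → ℂ} (hf : ACLoc f) : ACLoc fun x => f (-x) := by
  have hi : LocallyIntegrable (fun x => deriv f (-x)) volume :=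
    locallyIntegrable_of_intervalIntegrable fun a b => by
      simpa using (IntervalIntegrable.iff_comp_neg enorm_ne_top).1
        (locallyIntegrable_intervalIntegrable hf.locallyIntegrable_deriv (-a) (-b))
  have h : (fun x => f (-x)) = fun x => f 0 - ∫ t in (0 : ℝ)..x, deriv f (-t) := by
    ext x
    rw [intervalIntegral.integral_comp_neg, neg_zero, intervalIntegral.integral_symm,
      (hf.integral_eq_sub (hf.ae_differentiableAt.mono fun x hx => hx.hasDerivAt) 0 (-x)).2]
    ring
  rw [h]
  exact (ACLoc.const _).sub (acLoc_integral hi 0)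

/-! ### Linear Volterra equations and existence of solutions. -/

/-- The exponential weight `exp (2 |∫₀ˣ m|)` in which Volterra operators with kernel bounded by `m`
are contractions. -/
def volterraWeight (m : ℝ → ℝ) (x : ℝ) : ℝ := Real.exp (2 * |∫ t in (0 : ℝ)..x, m t|)

theorem volterraWeight_pos (m : ℝ → ℝ) (x : ℝ) : 0 < volterraWeight m x := Real.exp_pos _

theorem one_le_volterraWeight (m : ℝ → ℝ) (x : ℝ) : 1 ≤ volterraWeight m x :=
  Real.one_le_exp (by positivity)

theorem continuous_integral_of_locallyIntegrable {m : ℝ → ℝ} (hm : LocallyIntegrable m volume) :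
    Continuous fun x => ∫ t in (0 : ℝ)..x, m t :=
  intervalIntegral.continuous_primitive (locallyIntegrable_intervalIntegrable hm) 0

theorem continuous_volterraWeight {m : ℝ → ℝ} (hm : LocallyIntegrable m volume) :
    Continuous (volterraWeight m) := by
  have := continuous_integral_of_locallyIntegrable hm
  unfold volterraWeight
  fun_prop

theorem integral_mul_exp_integral {m : ℝ → ℝ} (hm : LocallyIntegrable m volume) (s a b : ℝ) :
    ∫ x in a..b, s * m x * Real.exp (s * ∫ t in (0 : ℝ)..x, m t) =
      Real.exp (s * ∫ t in (0 : ℝ)..b, m t) - Real.exp (s * ∫ t in (0 : ℝ)..a, m t) := by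
  have hcont := continuous_integral_of_locallyIntegrable hm
  have hi : ∀ a b, IntervalIntegrable
      (fun x => s * m x * Real.exp (s * ∫ t in (0 : ℝ)..x, m t)) volume a b := fun a b =>
    IntervalIntegrable.mul_continuousOn
      (IntervalIntegrable.const_mul (locallyIntegrable_intervalIntegrable hm a b) s)
      (by fun_prop)
  refine integral_eq_sub_of_ae_hasDerivAt (F := fun x => Real.exp (s * ∫ t in (0 : ℝ)..x, m t))
    (fun a b => ?_) ?_ ?_ a b
  -- The exponential is Lipschitz only on bounded sets; the primitive of `m` stays in `[-R, R]` on
  -- the interval.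
  · obtain ⟨R, hR⟩ := isCompact_uIcc.exists_bound_of_continuousOn
      (hcont.continuousOn (s := uIcc a b))
    have hexp : ContDiffOn ℝ 1 (fun r => Real.exp (s * r)) (Icc (-R) R) := by
      fun_prop
    obtain ⟨K, hK⟩ := hexp.exists_lipschitzOnWith (by decide) (convex_Icc _ _) isCompact_Icc
    refine absolutelyContinuousOnInterval_of_dist_le K
      (absolutelyContinuousOnInterval_integral hm 0 a b) fun x hx y hy => ?_
    exact hK.dist_le_mul _ (abs_le.1 (hR x hx)) _ (abs_le.1 (hR y hy))
  · exact locallyIntegrable_of_intervalIntegrable hi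
  · filter_upwards [LocallyIntegrable.ae_hasDerivAt_integral hm] with x hx
    exact ((hx 0).const_mul s).exp.congr_deriv (by ring)

/-- On each half-line the primitive of `m` has a fixed sign, so the weight is `exp (s ∫ m)` with `s
= ±2`, and `m` times it is the derivative of the weight divided by `s`. This is the source of the
contraction constant `1/2`. -/
theorem abs_integral_mul_volterraWeight_le {m : ℝ → ℝ} (hm : LocallyIntegrable m volume)
    (hm0 : ∀ x, 0 ≤ m x) (x : ℝ) :
    |∫ t in (0 : ℝ)..x, m t * volterraWeight m t| ≤ volterraWeight m x / 2 := by
  have key : ∀ s : ℝ, |s| = 2 →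
      (∀ t ∈ uIcc 0 x, s * (∫ r in (0 : ℝ)..t, m r) = 2 * |∫ r in (0 : ℝ)..t, m r|) →
      |∫ t in (0 : ℝ)..x, m t * volterraWeight m t| ≤ volterraWeight m x / 2 := by
    intro s hs h
    have h1 := integral_mul_exp_integral hm s 0 x
    have h2 : ∫ t in (0 : ℝ)..x, s * m t * Real.exp (s * ∫ r in (0 : ℝ)..t, m r) =
        s * ∫ t in (0 : ℝ)..x, m t * volterraWeight m t := by
      rw [← intervalIntegral.integral_const_mul]
      refine intervalIntegral.integral_congr fun t ht => ?_
      simp only [h t ht, volterraWeight]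
      ring
    rw [h2, h x right_mem_uIcc] at h1
    have h3 : 2 * |∫ t in (0 : ℝ)..x, m t * volterraWeight m t| =
        |volterraWeight m x - 1| := by
      rw [← hs, ← abs_mul, h1]
      simp [volterraWeight]
    rw [abs_of_nonneg (sub_nonneg.2 (one_le_volterraWeight m x))] at h3
    linarith
  rcases le_total 0 x with hx | hx
  · refine key 2 (by norm_num) fun t ht => ?_
    rw [uIcc_of_le hx] at ht
    rw [abs_of_nonneg (intervalIntegral.integral_nonneg ht.1 fun _ _ => hm0 _)]
  · refine key (-2) (by norm_num) fun t ht => ?_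
    rw [uIcc_of_ge hx] at ht
    have : 0 ≤ ∫ r in t..(0 : ℝ), m r :=
      intervalIntegral.integral_nonneg ht.2 fun _ _ => hm0 _
    rw [intervalIntegral.integral_symm, abs_neg, abs_of_nonneg this]
    ring

theorem intervalIntegrable_of_norm_le_mul {E : Type*} [NormedAddCommGroup E] [NormedSpace ℝ E]
    {B : ℝ → E →ₗ[ℝ] E} {m : ℝ → ℝ}
    (hm : LocallyIntegrable m volume) (hB : ∀ t z, ‖B t z‖ ≤ m t * ‖z‖)
    (hmeas : ∀ Y : ℝ → E, Continuous Y → AEStronglyMeasurable (fun t => B t (Y t)) volume)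
    {Y : ℝ → E} (hY : Continuous Y) (a b : ℝ) :
    IntervalIntegrable (fun t => B t (Y t)) volume a b :=
  (IntervalIntegrable.mul_continuousOn (locallyIntegrable_intervalIntegrable hm a b)
    hY.norm.continuousOn).mono_fun' (hmeas Y hY).restrict (ae_of_all _ fun t => hB t (Y t))

/-- Global solvability of linear Volterra equations with locally integrable coefficients. -/
theorem exists_continuous_eq_add_integral {E : Type*} [NormedAddCommGroup E] [NormedSpace ℝ E]
    [CompleteSpace E] {B : ℝ → E →ₗ[ℝ] E} {m : ℝ → ℝ}
    (hm : LocallyIntegrable m volume) (hB : ∀ t z, ‖B t z‖ ≤ m t * ‖z‖) (hm0 : ∀ t, 0 ≤ m t)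
    (hmeas : ∀ Y : ℝ → E, Continuous Y → AEStronglyMeasurable (fun t => B t (Y t)) volume)
    (Y₀ : E) :
    ∃ Y : ℝ → E, Continuous Y ∧ ∀ x, Y x = Y₀ + ∫ t in (0 : ℝ)..x, B t (Y t) := by
  set W := volterraWeight m with hW
  have hWc : Continuous W := continuous_volterraWeight hm
  have hWpos : ∀ x, 0 < W x := volterraWeight_pos m
  have hint {Y : ℝ → E} (hY : Continuous Y) := intervalIntegrable_of_norm_le_mul hm hB hmeas hY
  have hmW : ∀ a b, IntervalIntegrable (fun t => m t * W t) volume a b := fun a b =>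
    IntervalIntegrable.mul_continuousOn (locallyIntegrable_intervalIntegrable hm a b)
      hWc.continuousOn
  have hcont {Y : ℝ → E} (hY : Continuous Y) : Continuous fun x => ∫ t in (0 : ℝ)..x, B t (Y t) :=
    intervalIntegral.continuous_primitive (hint hY) 0
  have hbound (Z : BoundedContinuousFunction ℝ E) (x : ℝ) :
      ‖∫ t in (0 : ℝ)..x, B t (W t • Z t)‖ ≤ W x / 2 * ‖Z‖ := by
    have h1 : ‖∫ t in (0 : ℝ)..x, B t (W t • Z t)‖ ≤
        |∫ t in (0 : ℝ)..x, m t * W t * ‖Z‖| := by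
      refine intervalIntegral.norm_integral_le_abs_of_norm_le ?_ ?_
      · refine ae_of_all _ fun t => (hB t _).trans ?_
        rw [norm_smul, Real.norm_of_nonneg (hWpos t).le, mul_assoc]
        exact mul_le_mul_of_nonneg_left
          (mul_le_mul_of_nonneg_left (Z.norm_coe_le_norm t) (hWpos t).le) (hm0 t)
      · exact IntervalIntegrable.mul_const (hmW _ _) _
    rw [intervalIntegral.integral_mul_const, abs_mul, abs_of_nonneg (norm_nonneg Z)] at h1
    exact h1.trans (mul_le_mul_of_nonneg_right
      (abs_integral_mul_volterraWeight_le hm hm0 x) (norm_nonneg _))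
  have hZc (Z : BoundedContinuousFunction ℝ E) : Continuous fun t => W t • Z t :=
    hWc.smul Z.continuous
  -- Substituting `Y = W • Z` with `Z` bounded makes the integral equation a fixed point problem
  -- that contracts on the whole line at once, so no local solutions have to be glued.
  let Φ : BoundedContinuousFunction ℝ E → BoundedContinuousFunction ℝ E := fun Z =>
    BoundedContinuousFunction.ofNormedAddCommGroup
      (fun x => (W x)⁻¹ • (Y₀ + ∫ t in (0 : ℝ)..x, B t (W t • Z t)))
      ((hWc.inv₀ fun x => (hWpos x).ne').smul (continuous_const.add (hcont (hZc Z))))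
      (‖Y₀‖ + 1 / 2 * ‖Z‖) (fun x => by
        rw [norm_smul, norm_inv, Real.norm_of_nonneg (hWpos x).le, inv_mul_le_iff₀ (hWpos x)]
        refine (norm_add_le _ _).trans ?_
        have h1 := hbound Z x
        have h2 : ‖Y₀‖ ≤ W x * ‖Y₀‖ :=
          le_mul_of_one_le_left (norm_nonneg _) (one_le_volterraWeight m x)
        linarith)
  have hΦ : ContractingWith (1 / 2) Φ := by
    refine ⟨by norm_num, LipschitzWith.of_dist_le_mul fun Z Z' => ?_⟩
    rw [BoundedContinuousFunction.dist_le (by positivity)]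
    intro x
    have h1 : Φ Z x - Φ Z' x = (W x)⁻¹ • ∫ t in (0 : ℝ)..x, B t (W t • (Z - Z') t) := by
      simp only [Φ, BoundedContinuousFunction.coe_ofNormedAddCommGroup]
      rw [← smul_sub, add_sub_add_left_eq_sub,
        ← intervalIntegral.integral_sub (hint (hZc Z) _ _) (hint (hZc Z') _ _)]
      simp only [← map_sub, ← smul_sub, BoundedContinuousFunction.coe_sub, Pi.sub_apply]
    rw [dist_eq_norm, h1, norm_smul, norm_inv, Real.norm_of_nonneg (hWpos x).le,
      inv_mul_le_iff₀ (hWpos x), dist_eq_norm]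
    have h2 := hbound (Z - Z') x
    push_cast
    linarith
  obtain ⟨Z, hZ⟩ : ∃ Z, Φ Z = Z := ⟨_, hΦ.fixedPoint_isFixedPt⟩
  refine ⟨fun x => W x • Z x, hZc Z, fun x => ?_⟩
  have h1 : (W x)⁻¹ • (Y₀ + ∫ t in (0 : ℝ)..x, B t (W t • Z t)) = Z x := DFunLike.congr_fun hZ x
  dsimp only
  conv_lhs => rw [← h1]
  rw [smul_smul, mul_inv_cancel₀ (hWpos x).ne', one_smul]

/-- Existence for the linear equation `D²y = -p y` with locally integrable `p`. -/
theorem exists_hasDerivAt_linear {p : ℝ → ℂ} (hp : LocallyIntegrable p volume) (y₀ v₀ : ℂ) :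
    ∃ y v : ℝ → ℂ, y 0 = y₀ ∧ v 0 = v₀ ∧ (∀ x, HasDerivAt y (v x) x) ∧ ACLoc v ∧
      ∀ᵐ x : ℝ, HasDerivAt v (-(p x * y x)) x := by
  -- The first-order system for `(y, y')`. In the sup norm its matrix is bounded by `1 + ‖p t‖`.
  let B : ℝ → (ℂ × ℂ) →ₗ[ℝ] (ℂ × ℂ) := fun t =>
    { toFun := fun z => (z.2, -(p t * z.1))
      map_add' := fun z w => by
        ext <;> simp
        ring
      map_smul' := fun c z => by
        ext <;> simp
        ring }
  have hm : LocallyIntegrable (fun t => 1 + ‖p t‖) volume :=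
    locallyIntegrable_of_intervalIntegrable fun a b => intervalIntegrable_const.add
      (locallyIntegrable_intervalIntegrable hp a b).norm
  have hB : ∀ t z, ‖B t z‖ ≤ (1 + ‖p t‖) * ‖z‖ := fun t z => by
    refine max_le ?_ ?_
    · calc ‖z.2‖ ≤ ‖z‖ := norm_snd_le z
        _ ≤ (1 + ‖p t‖) * ‖z‖ := le_mul_of_one_le_left (norm_nonneg _) (by simp)
    · change ‖-(p t * z.1)‖ ≤ _
      rw [norm_neg, norm_mul]
      exact mul_le_mul (by simp) (norm_fst_le z) (norm_nonneg _) (by positivity)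
  have hmeas (Y : ℝ → ℂ × ℂ) (hY : Continuous Y) :
      AEStronglyMeasurable (fun t => B t (Y t)) volume :=
    hY.snd.aestronglyMeasurable.prodMk
      (hp.aestronglyMeasurable.mul hY.fst.aestronglyMeasurable).neg
  obtain ⟨Y, hYc, hY⟩ := exists_continuous_eq_add_integral (B := B) hm hB
    (fun t => by positivity) hmeas (y₀, v₀)
  have hpi : LocallyIntegrable (fun t => -(p t * (Y t).1)) volume :=
    locallyIntegrable_of_intervalIntegrable fun a b => IntervalIntegrable.neg
      (IntervalIntegrable.mul_continuousOn (locallyIntegrable_intervalIntegrable hp a b)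
        hYc.fst.continuousOn)
  have hsplit : ∀ x, ∫ t in (0 : ℝ)..x, B t (Y t) =
      (∫ t in (0 : ℝ)..x, (Y t).2, ∫ t in (0 : ℝ)..x, -(p t * (Y t).1)) := fun x => by
    have hi : IntervalIntegrable (fun t => B t (Y t)) volume 0 x :=
      intervalIntegrable_of_norm_le_mul hm hB hmeas hYc 0 x
    exact Prod.ext
      ((ContinuousLinearMap.fst ℝ ℂ ℂ).intervalIntegral_comp_comm hi).symm
      ((ContinuousLinearMap.snd ℝ ℂ ℂ).intervalIntegral_comp_comm hi).symm
  have h1 : (fun x => (Y x).1) = fun x => y₀ + ∫ t in (0 : ℝ)..x, (Y t).2 := by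
    ext x; rw [hY x, hsplit]; rfl
  have h2 : (fun x => (Y x).2) = fun x => v₀ + ∫ t in (0 : ℝ)..x, -(p t * (Y t).1) := by
    ext x; rw [hY x, hsplit]; rfl
  refine ⟨fun x => (Y x).1, fun x => (Y x).2, ?_, ?_, fun x => ?_, ?_, ?_⟩
  · exact (congrFun h1 0).trans (by simp)
  · exact (congrFun h2 0).trans (by simp)
  · rw [h1]
    exact (intervalIntegral.integral_hasDerivAt_right (hYc.snd.intervalIntegrable _ _)
      (hYc.snd.stronglyMeasurableAtFilter _ _) hYc.snd.continuousAt).const_add _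
  · rw [h2]
    exact (ACLoc.const _).add (acLoc_integral hpi 0)
  · filter_upwards [LocallyIntegrable.ae_hasDerivAt_integral hpi] with x hx
    rw [h2]
    exact (hx 0).const_add _

/-! ### Solutions, their symmetries, the Lagrange identity and the pair `w₁, w₂`. -/

theorem IsSolution.of_hasDerivAt {q : ℝ → ℝ} {l : ℂ} {y v : ℝ → ℂ}
    (hy : ∀ x, HasDerivAt y (v x) x) (hv : ACLoc v)
    (h : ∀ᵐ x : ℝ, HasDerivAt v (-((q x + l) * y x)) x) : IsSolution q l y := by
  refine ⟨IsRegular.of_hasDerivAt hy hv, ?_⟩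
  have hd : deriv y = v := funext fun x => (hy x).deriv
  filter_upwards [h] with x hx
  simp only [tau, hd, hx.deriv]
  ring

theorem exists_isSolution {q : ℝ → ℝ} (hq : LocallyIntegrable q volume) (l y₀ v₀ : ℂ) :
    ∃ y, IsSolution q l y ∧ y 0 = y₀ ∧ deriv y 0 = v₀ := by
  have hp : LocallyIntegrable (fun x => (q x : ℂ) + l) volume :=
    locallyIntegrable_of_intervalIntegrable fun a b => by
      have hi := locallyIntegrable_intervalIntegrable hq a b
      exact IntervalIntegrable.add ⟨hi.1.ofReal, hi.2.ofReal⟩ intervalIntegrable_const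
  obtain ⟨y, v, h1, h2, h3, h4, h5⟩ := exists_hasDerivAt_linear hp y₀ v₀
  exact ⟨y, IsSolution.of_hasDerivAt h3 h4 h5, h1, by rw [(h3 0).deriv, h2]⟩

theorem deriv_conj (f : ℝ → ℂ) : (deriv fun x => conj (f x)) = fun x => conj (deriv f x) :=
  funext fun x => (deriv.star : deriv (fun y => star (f y)) x = star (deriv f x))

theorem deriv_comp_neg_eq (f : ℝ → ℂ) : (deriv fun x => f (-x)) = fun x => -deriv f (-x) :=
  funext fun x => deriv_comp_neg f x

theorem IsRegular.conj {y : ℝ → ℂ} (hy : IsRegular y) : IsRegular fun x => conj (y x) :=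
  ⟨fun x => (hy.differentiable x).star, hy.acLoc.conj, by
    rw [deriv_conj]; exact hy.acLoc_deriv.conj⟩

theorem IsRegular.comp_neg {y : ℝ → ℂ} (hy : IsRegular y) : IsRegular fun x => y (-x) :=
  ⟨hy.differentiable.comp differentiable_neg, hy.acLoc.comp_neg, by
    rw [deriv_comp_neg_eq]; exact hy.acLoc_deriv.comp_neg.neg⟩

theorem tau_conj (q : ℝ → ℝ) (y : ℝ → ℂ) (x : ℝ) :
    tau q (fun x => conj (y x)) x = conj (tau q y x) := by
  simp only [tau, deriv_conj, map_sub, map_neg, map_mul, Complex.conj_ofReal]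

theorem tau_comp_neg {q : ℝ → ℝ} (heven : ∀ x, q (-x) = q x) (y : ℝ → ℂ) (x : ℝ) :
    tau q (fun x => y (-x)) x = tau q y (-x) := by
  simp only [tau, deriv_comp_neg_eq, heven]
  rw [deriv.fun_neg, deriv_comp_neg, neg_neg]

theorem IsSolution.add {q : ℝ → ℝ} {l : ℂ} {y z : ℝ → ℂ} (hy : IsSolution q l y)
    (hz : IsSolution q l z) : IsSolution q l (y + z) := by
  refine ⟨hy.1.add hz.1, ?_⟩
  filter_upwards [tau_add q hy.1 hz.1, hy.2, hz.2] with x h h1 h2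
  rw [h, Pi.add_apply, h1, h2, Pi.add_apply, mul_add]

theorem IsSolution.smul {q : ℝ → ℝ} {l : ℂ} {y : ℝ → ℂ} (c : ℂ) (hy : IsSolution q l y) :
    IsSolution q l (c • y) := by
  refine ⟨hy.1.smul c, ?_⟩
  filter_upwards [tau_smul q c hy.1, hy.2] with x h h1
  rw [h, Pi.smul_apply, h1, Pi.smul_apply, smul_eq_mul, smul_eq_mul]
  ring

theorem IsSolution.conj {q : ℝ → ℝ} {y : ℝ → ℂ} (hy : IsSolution q 0 y) :
    IsSolution q 0 fun x => conj (y x) := by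
  refine ⟨hy.1.conj, ?_⟩
  filter_upwards [hy.2] with x h
  simp [tau_conj, h]

theorem IsSolution.comp_neg {q : ℝ → ℝ} (heven : ∀ x, q (-x) = q x) {l : ℂ} {y : ℝ → ℂ}
    (hy : IsSolution q l y) : IsSolution q l fun x => y (-x) := by
  refine ⟨hy.1.comp_neg, ?_⟩
  filter_upwards [(Measure.measurePreserving_neg (volume : Measure ℝ)).quasiMeasurePreserving.ae
    hy.2] with x h
  rw [tau_comp_neg heven, h]

theorem memLp_two_of_continuous {y : ℝ → ℂ} (hc : Continuous y) {a b : ℝ}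
    (ha : MemLp y 2 (volume.restrict (Ioi a))) (hb : MemLp y 2 (volume.restrict (Iio b))) :
    MemLp y 2 volume := by
  rw [memLp_two_iff_integrable_sq_norm hc.aestronglyMeasurable] at ha hb ⊢
  have hm : IntegrableOn (fun x => ‖y x‖ ^ 2) (Icc b a) :=
    (hc.norm.pow 2).continuousOn.integrableOn_compact isCompact_Icc
  have h : (univ : Set ℝ) = Iio b ∪ (Icc b a ∪ Ioi a) := by
    ext x
    simp only [mem_univ, mem_union, mem_Iio, mem_Icc, mem_Ioi, true_iff]
    grind
  rw [← integrableOn_univ, h]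
  exact IntegrableOn.union hb (hm.union ha)

theorem IsSolution.mem_maxDomain {q : ℝ → ℝ} (htop : LimitCircleAtTop q)
    (hbot : LimitCircleAtBot q) {l : ℂ} {y : ℝ → ℂ} (hy : IsSolution q l y) :
    y ∈ maxDomain q := by
  obtain ⟨a, ha⟩ := htop l y hy
  obtain ⟨b, hb⟩ := hbot l y hy
  have h := memLp_two_of_continuous hy.1.differentiable.continuous ha hb
  exact ⟨hy.1, h, (memLp_congr_ae hy.2).2 (h.const_mul l)⟩

theorem IsRegular.acLoc_bracket {f g : ℝ → ℂ} (hf : IsRegular f) (hg : IsRegular g) :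
    ACLoc (bracket f g) :=
  (hf.acLoc.conj.mul hg.acLoc_deriv).sub (hf.acLoc_deriv.conj.mul hg.acLoc)

theorem IsRegular.ae_hasDerivAt_bracket (q : ℝ → ℝ) {f g : ℝ → ℂ} (hf : IsRegular f)
    (hg : IsRegular g) :
    ∀ᵐ x : ℝ, HasDerivAt (bracket f g)
      (conj (tau q f x) * g x - conj (f x) * tau q g x) x := by
  filter_upwards [hf.acLoc_deriv.ae_differentiableAt, hg.acLoc_deriv.ae_differentiableAt]
    with x h1 h2
  have e1 := (hf.differentiable x).hasDerivAt.star
  have e2 := h1.hasDerivAt.star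
  refine ((e1.mul h2.hasDerivAt).sub (e2.mul (hg.differentiable x).hasDerivAt)).congr_deriv ?_
  simp only [tau, map_sub, map_neg, map_mul, Complex.conj_ofReal, ← starRingEnd_apply]
  ring

/-- The Lagrange identity. -/
theorem IsRegular.integral_lagrange (q : ℝ → ℝ) {f g : ℝ → ℂ} (hf : IsRegular f)
    (hg : IsRegular g) (a b : ℝ) :
    ∫ x in a..b, (conj (tau q f x) * g x - conj (f x) * tau q g x) =
      bracket f g b - bracket f g a :=
  ((hf.acLoc_bracket hg).integral_eq_sub (hf.ae_hasDerivAt_bracket q hg) a b).2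

/-- Constancy of the Wronskian: the integrand of the Lagrange identity vanishes almost everywhere.
-/
theorem IsSolution.bracket_eq {q : ℝ → ℝ} {f g : ℝ → ℂ} (hf : IsSolution q 0 f)
    (hg : IsSolution q 0 g) (a b : ℝ) : bracket f g a = bracket f g b := by
  have h := hf.1.integral_lagrange q hg.1 b a
  rw [intervalIntegral.integral_congr_ae (g := fun _ => 0)] at h
  · simpa [sub_eq_zero] using h.symm
  · filter_upwards [hf.2, hg.2] with x h1 h2 _
    simp [h1, h2]

theorem conj_deriv_of_real {w : ℝ → ℂ} (h : ∀ x, (w x).im = 0) (x : ℝ) :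
    conj (deriv w x) = deriv w x := by
  have hc : (fun x => conj (w x)) = w := funext fun x => Complex.conj_eq_iff_im.2 (h x)
  rw [← congrFun (deriv_conj w) x, hc]

theorem bracket_self_of_real {w : ℝ → ℂ} (h : ∀ x, (w x).im = 0) (x : ℝ) : bracket w w x = 0 := by
  rw [bracket, conj_deriv_of_real h, Complex.conj_eq_iff_im.2 (h x)]
  ring

theorem exists_isBoundaryPair {q : ℝ → ℝ} (hq : LocallyIntegrable q volume)
    (heven : ∀ x, q (-x) = q x) (htop : LimitCircleAtTop q) (hbot : LimitCircleAtBot q) :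
    ∃ w₁ w₂ : ℝ → ℂ, IsBoundaryPair q w₁ w₂ := by
  -- The initial data make `w₁ w₂' - w₁' w₂` equal to `1` at `0`. Real parts and then odd or even
  -- parts are taken below, which gives reality and parity without appeal to uniqueness for the
  -- initial value problem.
  obtain ⟨u, hu, hu0, hu1⟩ := exists_isSolution hq 0 0 (-1)
  obtain ⟨v, hv, hv0, hv1⟩ := exists_isSolution hq 0 1 0
  have hreal {y : ℝ → ℂ} (hy : IsSolution q 0 y) :
      IsSolution q 0 fun x => ((y x).re : ℂ) := by
    have : (fun x => ((y x).re : ℂ)) = (1 / 2 : ℂ) • (y + fun x => conj (y x)) := by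
      ext x
      simp [Complex.re_eq_add_conj, div_eq_inv_mul]
    rw [this]
    exact (hy.add hy.conj).smul _
  set u' : ℝ → ℂ := fun x => ((u x).re : ℂ) with hu'
  set v' : ℝ → ℂ := fun x => ((v x).re : ℂ) with hv'
  have hus : IsSolution q 0 u' := hreal hu
  have hvs : IsSolution q 0 v' := hreal hv
  have hud : deriv u' 0 = -1 := by
    have : HasDerivAt u' ((deriv u 0).re : ℂ) 0 :=
      (Complex.reCLM.hasFDerivAt.comp_hasDerivAt 0
        (hu.1.differentiable 0).hasDerivAt).ofReal_comp
    rw [this.deriv, hu1]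
    simp
  set w₁ : ℝ → ℂ := (1 / 2 : ℂ) • (u' + (-1 : ℂ) • fun x => u' (-x)) with hw₁
  set w₂ : ℝ → ℂ := (1 / 2 : ℂ) • (v' + fun x => v' (-x)) with hw₂
  have h₁ : IsSolution q 0 w₁ := (hus.add ((hus.comp_neg heven).smul _)).smul _
  have h₂ : IsSolution q 0 w₂ := (hvs.add (hvs.comp_neg heven)).smul _
  have r₁ : ∀ x, (w₁ x).im = 0 := fun x => by simp [hw₁, hu']
  have r₂ : ∀ x, (w₂ x).im = 0 := fun x => by simp [hw₂, hv']
  have hd1 : deriv w₁ 0 = -1 := by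
    have e := (hus.1.differentiable 0).hasDerivAt
    have e' : HasDerivAt (fun x => u' (-x)) (-deriv u' 0) 0 := by
      have := (hus.comp_neg heven).1.differentiable 0 |>.hasDerivAt
      simpa [deriv_comp_neg_eq] using this
    have := ((e.add (e'.const_smul (-1 : ℂ))).const_smul (1 / 2 : ℂ)).deriv
    rw [hw₁, this, hud]
    simp
    norm_num
  have hb : ∀ x, bracket w₁ w₂ x = 1 := fun x => by
    rw [h₁.bracket_eq h₂ x 0, bracket, hd1]
    simp [hw₁, hw₂, hv', hv0]
    norm_num
  have hc {w z : ℝ → ℂ} {c : ℂ} {F : Filter ℝ} (h : ∀ x, bracket w z x = c) :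
      Tendsto (bracket w z) F (𝓝 c) := by
    rw [funext h]; exact tendsto_const_nhds
  refine ⟨w₁, w₂, h₁.mem_maxDomain htop hbot, h₂.mem_maxDomain htop hbot, h₁, h₂, r₁, r₂,
    fun x => ?_, fun x => ?_, hc hb, hc hb, hc (bracket_self_of_real r₁),
    hc (bracket_self_of_real r₁), hc (bracket_self_of_real r₂), hc (bracket_self_of_real r₂)⟩
  · simp [hw₁]
  · simp [hw₂]
    ring

/-! ### Brackets at infinity and Green's formula. -/

theorem integrable_conj_mul {f g : ℝ → ℂ} (hf : MemLp f 2 volume) (hg : MemLp g 2 volume) :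
    Integrable (fun x => conj (f x) * g x) volume :=
  MemLp.integrable_mul (p := 2) (q := 2) hf.star hg

theorem inner_toLp {f g : ℝ → ℂ} (hf : MemLp f 2 volume) (hg : MemLp g 2 volume) :
    inner ℂ (hf.toLp f) (hg.toLp g) = ∫ x, conj (f x) * g x := by
  rw [L2.inner_def]
  refine integral_congr_ae ?_
  filter_upwards [hf.coeFn_toLp, hg.coeFn_toLp] with x h1 h2
  rw [h1, h2, RCLike.inner_apply, mul_comm]

section Limits

variable {q : ℝ → ℝ} (f g : maxDomain q)

/-- Products of square integrable functions are integrable; this is why the brackets have limits at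
`±∞`. -/
theorem integrable_lagrange :
    Integrable (fun x => conj (tau q f x) * (g : ℝ → ℂ) x - conj ((f : ℝ → ℂ) x) * tau q g x)
      volume :=
  (integrable_conj_mul f.2.2.2 g.2.2.1).sub (integrable_conj_mul f.2.2.1 g.2.2.2)

theorem tendsto_bracketTop : Tendsto (bracket f g) atTop (𝓝 (bracketTop f g)) := by
  have h := intervalIntegral_tendsto_integral_Ioi 0 (integrable_lagrange f g).integrableOn
    tendsto_id
  simp only [f.2.1.integral_lagrange q g.2.1, id] at h
  refine tendsto_nhds_limUnder ⟨_, (h.add_const (bracket f g 0)).congr fun x => ?_⟩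
  ring

theorem tendsto_bracketBot : Tendsto (bracket f g) atBot (𝓝 (bracketBot f g)) := by
  have h := intervalIntegral_tendsto_integral_Iic 0 (integrable_lagrange f g).integrableOn
    tendsto_id
  simp only [f.2.1.integral_lagrange q g.2.1, id] at h
  refine tendsto_nhds_limUnder ⟨_, (h.const_sub (bracket f g 0)).congr fun x => ?_⟩
  ring

/-- The Lagrange identity on `[-x, x]` as `x → ∞`. It translates adjointness into a statement about
boundary values. -/
theorem bracketTop_sub_bracketBot :
    bracketTop f g - bracketBot f g =
      inner ℂ (tauL2 q f) (toL2 q g) - inner ℂ (toL2 q f) (tauL2 q g) := by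
  have h := intervalIntegral_tendsto_integral (integrable_lagrange f g) tendsto_neg_atTop_atBot
    tendsto_id
  simp only [f.2.1.integral_lagrange q g.2.1, id] at h
  rw [integral_sub (integrable_conj_mul f.2.2.2 g.2.2.1) (integrable_conj_mul f.2.2.1 g.2.2.2),
    ← inner_toLp f.2.2.2 g.2.2.1, ← inner_toLp f.2.2.1 g.2.2.2] at h
  exact tendsto_nhds_unique
    ((tendsto_bracketTop f g).sub ((tendsto_bracketBot f g).comp tendsto_neg_atTop_atBot)) h

end Limits

/-! ### The inhomogeneous equation `τ_q u = h`. -/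

theorem bracket_of_real {w : ℝ → ℂ} (h : ∀ x, (w x).im = 0) (f : ℝ → ℂ) (x : ℝ) :
    bracket w f x = w x * deriv f x - deriv w x * f x := by
  rw [bracket, conj_deriv_of_real h, Complex.conj_eq_iff_im.2 (h x)]

namespace IsBoundaryPair

variable {q : ℝ → ℝ} {w₁ w₂ : ℝ → ℂ} (hw : IsBoundaryPair q w₁ w₂)
include hw

/-- The bracket is constant, so its limit at `∞` is its value everywhere. -/
theorem wronskian (x : ℝ) : w₁ x * deriv w₂ x - deriv w₁ x * w₂ x = 1 := by
  rw [← bracket_of_real hw.real₁]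
  have h : bracket w₁ w₂ = fun _ => bracket w₁ w₂ x :=
    funext fun y => hw.sol₁.bracket_eq hw.sol₂ y x
  have h1 := hw.top₁₂
  rw [h] at h1
  exact tendsto_nhds_unique tendsto_const_nhds h1

theorem continuous₁ : Continuous w₁ := hw.sol₁.1.differentiable.continuous

theorem continuous₂ : Continuous w₂ := hw.sol₂.1.differentiable.continuous

theorem ae_hasDerivAt₁ : ∀ᵐ x : ℝ, HasDerivAt (deriv w₁) (-(q x * w₁ x)) x := by
  filter_upwards [hw.sol₁.1.acLoc_deriv.ae_differentiableAt, hw.sol₁.2] with x h1 h2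
  refine h1.hasDerivAt.congr_deriv ?_
  rw [tau] at h2
  linear_combination -h2

theorem ae_hasDerivAt₂ : ∀ᵐ x : ℝ, HasDerivAt (deriv w₂) (-(q x * w₂ x)) x := by
  filter_upwards [hw.sol₂.1.acLoc_deriv.ae_differentiableAt, hw.sol₂.2] with x h1 h2
  refine h1.hasDerivAt.congr_deriv ?_
  rw [tau] at h2
  linear_combination -h2

/-- Variation of constants. -/
theorem variation_of_constants {h : ℝ → ℂ} (hh : LocallyIntegrable h volume) (c : ℝ) :
    IsRegular (fun x => w₁ x * (∫ t in c..x, w₂ t * h t) - w₂ x * ∫ t in c..x, w₁ t * h t) ∧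
    tau q (fun x => w₁ x * (∫ t in c..x, w₂ t * h t) - w₂ x * ∫ t in c..x, w₁ t * h t)
      =ᵐ[volume] h := by
  have hi {w : ℝ → ℂ} (hc : Continuous w) : LocallyIntegrable (fun t => w t * h t) volume :=
    locallyIntegrable_of_intervalIntegrable fun a b => IntervalIntegrable.continuousOn_mul
      (locallyIntegrable_intervalIntegrable hh a b) hc.continuousOn
  set F₁ : ℝ → ℂ := fun x => ∫ t in c..x, w₁ t * h t with hF₁
  set F₂ : ℝ → ℂ := fun x => ∫ t in c..x, w₂ t * h t with hF₂
  have a₁ : ACLoc F₁ := acLoc_integral (hi hw.continuous₁) c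
  have a₂ : ACLoc F₂ := acLoc_integral (hi hw.continuous₂) c
  have d₁ := LocallyIntegrable.ae_hasDerivAt_integral (hi hw.continuous₁)
  have d₂ := LocallyIntegrable.ae_hasDerivAt_integral (hi hw.continuous₂)
  set v : ℝ → ℂ := fun x => deriv w₁ x * F₂ x - deriv w₂ x * F₁ x with hv
  have hvac : ACLoc v := (hw.sol₁.1.acLoc_deriv.mul a₂).sub (hw.sol₂.1.acLoc_deriv.mul a₁)
  have hu : ∀ x, HasDerivAt (fun x => w₁ x * F₂ x - w₂ x * F₁ x) (v x) x := by
    -- The terms containing `h` cancel in the first derivative, which leaves the continuous `v`; in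
    -- `v'` they combine to `-h` times the Wronskian.
    refine ((hw.sol₁.1.acLoc.mul a₂).sub (hw.sol₂.1.acLoc.mul a₁)).hasDerivAt_of_continuous
      ?_ hvac.continuous
    filter_upwards [d₁, d₂] with x h1 h2
    refine (((hw.sol₁.1.differentiable x).hasDerivAt.mul (h2 c)).sub
      ((hw.sol₂.1.differentiable x).hasDerivAt.mul (h1 c))).congr_deriv ?_
    simp only [hv, hF₁, hF₂]
    ring
  refine ⟨IsRegular.of_hasDerivAt hu hvac, ?_⟩
  filter_upwards [d₁, d₂, hw.ae_hasDerivAt₁, hw.ae_hasDerivAt₂] with x h1 h2 h3 h4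
  have hd : HasDerivAt v (-(q x * (w₁ x * F₂ x - w₂ x * F₁ x)) - h x) x := by
    refine ((h3.mul (h2 c)).sub (h4.mul (h1 c))).congr_deriv ?_
    have := hw.wronskian x
    simp only [hF₁, hF₂]
    linear_combination -h x * this
  have hd' : deriv (fun x => w₁ x * F₂ x - w₂ x * F₁ x) = v := funext fun x => (hu x).deriv
  change -deriv (deriv fun x => w₁ x * F₂ x - w₂ x * F₁ x) x -
    q x * (w₁ x * F₂ x - w₂ x * F₁ x) = h x
  rw [hd', hd.deriv]
  ring

/-- Based at `-R`, the variation of constants solution vanishes to the left of the support of `f`;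
orthogonality to `w₁` and `w₂` kills both coefficients to the right of it. -/
theorem exists_compactDomain_tau_eq {f : ℝ → ℂ} (hf : MemLp f 2 volume) {R : ℝ}
    (hR : ∀ x, R < |x| → f x = 0) (h₁ : ∫ x, w₁ x * f x = 0) (h₂ : ∫ x, w₂ x * f x = 0) :
    ∃ y ∈ compactDomain q, tau q y =ᵐ[volume] f := by
  have hfl : LocallyIntegrable f volume := hf.locallyIntegrable (by norm_num)
  obtain ⟨hreg, htau⟩ := hw.variation_of_constants hfl (-R)
  set u : ℝ → ℂ := fun x => w₁ x * (∫ t in (-R)..x, w₂ t * f t) -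
    w₂ x * ∫ t in (-R)..x, w₁ t * f t with hu
  have hvanish {w : ℝ → ℂ} (hi : ∫ x, w x * f x = 0) (x : ℝ) (hx : R < |x|) :
      ∫ t in (-R)..x, w t * f t = 0 := by
    rcases le_total 0 x with h0 | h0
    · rw [abs_of_nonneg h0] at hx
      by_cases hR0 : 0 ≤ R
      · rw [intervalIntegral.integral_of_le (by linarith), ← integral_Icc_eq_integral_Ioc,
          setIntegral_eq_integral_of_forall_compl_eq_zero, hi]
        intro t ht
        rw [hR t, mul_zero]
        simp only [mem_Icc, not_and_or, not_le] at ht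
        rcases ht with ht | ht
        · exact lt_of_lt_of_le (by linarith) (neg_le_abs t)
        · exact lt_of_lt_of_le (by linarith) (le_abs_self t)
      · have : (fun t => w t * f t) = fun _ => 0 := by
          ext t
          rw [hR t (by linarith [abs_nonneg t]), mul_zero]
        simp [this]
    · rw [abs_of_nonpos h0] at hx
      refine (intervalIntegral.integral_congr_ae (g := fun _ => 0) ?_).trans (by simp)
      have hne : ∀ᵐ t : ℝ, t ≠ -R := by simp [ae_iff, measure_singleton]
      filter_upwards [hne] with t htne ht
      rw [uIoc_of_ge (by linarith)] at ht
      rw [hR t, mul_zero]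
      have := lt_of_le_of_ne ht.2 htne
      exact lt_of_lt_of_le (by linarith) (neg_le_abs t)
  have hcs : HasCompactSupport u := by
    refine HasCompactSupport.intro (isCompact_Icc (a := -R) (b := R)) fun x hx => ?_
    have hx' : R < |x| := by
      by_contra hcon
      exact hx (abs_le.1 (not_lt.1 hcon))
    simp only [hu, hvanish h₁ x hx', hvanish h₂ x hx', mul_zero, sub_zero]
  exact ⟨⟨u, hreg, hreg.differentiable.continuous.memLp_of_hasCompactSupport hcs,
    (memLp_congr_ae htau).2 hf⟩, hcs, htau⟩

end IsBoundaryPair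

/-! ### The du Bois-Reymond argument for the adjoint of the pre-minimal operator. -/

theorem integral_Icc_mul_self_ne_zero {w : ℝ → ℂ} (hc : Continuous w) (hr : ∀ x, (w x).im = 0)
    (h : ∃ x ∈ Ioo (-1 : ℝ) 1, w x ≠ 0) : ∫ x in Icc (-1 : ℝ) 1, w x * w x ≠ 0 := by
  obtain ⟨x, hx, hne⟩ := h
  have hsq : ∀ x, w x * w x = (((w x).re ^ 2 : ℝ) : ℂ) := fun x => by
    apply Complex.ext <;> simp [hr x, sq]
  simp only [hsq]
  rw [integral_complex_ofReal, Complex.ofReal_ne_zero, integral_Icc_eq_integral_Ioc,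
    ← intervalIntegral.integral_of_le (by norm_num)]
  refine (intervalIntegral.integral_pos (by norm_num) (by fun_prop) (fun _ _ => sq_nonneg _)
    ⟨x, Ioo_subset_Icc_self hx, ?_⟩).ne'
  refine sq_pos_of_ne_zero fun h0 => hne (Complex.ext h0 (hr x))

theorem tau_eq_zero_of_notMem_tsupport (q : ℝ → ℝ) {y : ℝ → ℂ} {x : ℝ} (hx : x ∉ tsupport y) :
    tau q y x = 0 := by
  have h1 : deriv (deriv y) x = 0 := by
    by_contra hne
    exact hx (closure_minimal (support_deriv_subset (f := y)) (isClosed_tsupport y)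
      (support_deriv_subset hne))
  rw [tau, h1, image_eq_zero_of_notMem_tsupport hx]
  simp

/-- The Lagrange identity against a compactly supported function. -/
theorem integral_lagrange_of_hasCompactSupport (q : ℝ → ℝ) {u y : ℝ → ℂ} (hu : IsRegular u)
    (hy : IsRegular y) (hc : HasCompactSupport y) :
    Integrable (fun x => conj (tau q u x) * y x - conj (u x) * tau q y x) volume ∧
      ∫ x, (conj (tau q u x) * y x - conj (u x) * tau q y x) = 0 := by
  obtain ⟨R, hR⟩ := hc.isCompact.isBounded.exists_norm_le
  have hout : ∀ x, R < |x| → x ∉ tsupport y := fun x hx h => absurd (hR x h) (not_le.2 hx)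
  set r := |R| + 1 with hr
  have hRr : R < r := by linarith [le_abs_self R]
  have hr0 : 0 < r := by positivity
  have hbr : ∀ x, R < |x| → bracket u y x = 0 := fun x hx => by
    have h1 : deriv y x = 0 := by
      by_contra hne
      exact hout x hx (support_deriv_subset hne)
    rw [bracket, h1, image_eq_zero_of_notMem_tsupport (hout x hx)]
    simp
  have hsupp : Function.support (fun x => conj (tau q u x) * y x - conj (u x) * tau q y x) ⊆
      Ioc (-r) r := by
    intro x hx
    by_contra hcon
    have hx' : R < |x| := by
      by_contra hlt
      have := abs_le.1 (not_lt.1 hlt)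
      exact hcon ⟨by linarith [this.1], by linarith [this.2]⟩
    refine hx ?_
    simp only [tau_eq_zero_of_notMem_tsupport q (hout x hx'),
      image_eq_zero_of_notMem_tsupport (hout x hx'), mul_zero, sub_zero]
  obtain ⟨h1, h2⟩ := (hu.acLoc_bracket hy).integral_eq_sub (hu.ae_hasDerivAt_bracket q hy) (-r) r
  refine ⟨(integrableOn_iff_integrable_of_support_subset hsupp).1 h1.1, ?_⟩
  rw [← intervalIntegral.integral_eq_integral_of_support_subset hsupp, h2,
    hbr r (by rwa [abs_of_pos hr0]), hbr (-r) (by rwa [abs_neg, abs_of_pos hr0]), sub_zero]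

namespace IsBoundaryPair

variable {q : ℝ → ℝ} {w₁ w₂ : ℝ → ℂ} (hw : IsBoundaryPair q w₁ w₂)
include hw

/-- Vanishing near `0` would give `w₁ 0 = w₁' 0 = 0`, against the Wronskian being `1`. -/
theorem exists_ne_zero₁ : ∃ x ∈ Ioo (-1 : ℝ) 1, w₁ x ≠ 0 := by
  by_contra! hcon
  have h0 := hw.wronskian 0
  have hd : deriv w₁ 0 = 0 := by
    have : w₁ =ᶠ[𝓝 0] fun _ => 0 :=
      Filter.mem_of_superset (Ioo_mem_nhds (by norm_num) (by norm_num)) hcon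
    rw [this.deriv_eq, deriv_const]
  rw [hd, hcon 0 (by norm_num)] at h0
  simp at h0

theorem exists_ne_zero₂ : ∃ x ∈ Ioo (-1 : ℝ) 1, w₂ x ≠ 0 := by
  by_contra! hcon
  have h0 := hw.wronskian 0
  have hd : deriv w₂ 0 = 0 := by
    have : w₂ =ᶠ[𝓝 0] fun _ => 0 :=
      Filter.mem_of_superset (Ioo_mem_nhds (by norm_num) (by norm_num)) hcon
    rw [this.deriv_eq, deriv_const]
  rw [hd, hcon 0 (by norm_num)] at h0
  simp at h0

theorem integral_Icc_mul_eq_zero : ∫ x in Icc (-1 : ℝ) 1, w₁ x * w₂ x = 0 := by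
  rw [integral_Icc_eq_integral_Ioc, ← intervalIntegral.integral_of_le (by norm_num)]
  have h := intervalIntegral.integral_comp_neg (a := -1) (b := 1) fun x => w₁ x * w₂ x
  simp only [hw.odd₁, hw.even₂, neg_mul, intervalIntegral.integral_neg, neg_neg] at h
  linear_combination -(1 / 2 : ℂ) * h

/-- A locally integrable function that annihilates every compactly supported `L²` function
orthogonal to `w₁` and `w₂` is a linear combination of `w₁` and `w₂`. -/
theorem ae_eq_of_forall_integral_eq_zero {k : ℝ → ℂ} (hk : LocallyIntegrable k volume)
    (H : ∀ (f : ℝ → ℂ) (R : ℝ), MemLp f 2 volume → (∀ x, R < |x| → f x = 0) →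
      ∫ x, w₁ x * f x = 0 → ∫ x, w₂ x * f x = 0 → ∫ x, k x * f x = 0) :
    ∃ c₁ c₂ : ℂ, k =ᵐ[volume] fun x => c₁ * w₁ x + c₂ * w₂ x := by
  -- On this symmetric interval parity makes `w₁` and `w₂` orthogonal, so their Gram matrix is
  -- diagonal with nonzero entries `n₁`, `n₂`, and `c₁`, `c₂` are the projection coefficients of
  -- `k`.
  set I : Set ℝ := Icc (-1) 1 with hI
  set n₁ := ∫ x in I, w₁ x * w₁ x with hn₁
  set n₂ := ∫ x in I, w₂ x * w₂ x with hn₂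
  have hn₁0 : n₁ ≠ 0 := integral_Icc_mul_self_ne_zero hw.continuous₁ hw.real₁ hw.exists_ne_zero₁
  have hn₂0 : n₂ ≠ 0 := integral_Icc_mul_self_ne_zero hw.continuous₂ hw.real₂ hw.exists_ne_zero₂
  have h12 : ∫ x in I, w₁ x * w₂ x = 0 := hw.integral_Icc_mul_eq_zero
  have h21 : ∫ x in I, w₂ x * w₁ x = 0 := by simpa only [mul_comm] using h12
  set c₁ := (∫ x in I, k x * w₁ x) / n₁ with hc₁
  set c₂ := (∫ x in I, k x * w₂ x) / n₂ with hc₂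
  refine ⟨c₁, c₂, ?_⟩
  have hcont : Continuous fun x => c₁ * w₁ x + c₂ * w₂ x :=
    (continuous_const.mul hw.continuous₁).add (continuous_const.mul hw.continuous₂)
  have hloc : LocallyIntegrable (fun x => k x - (c₁ * w₁ x + c₂ * w₂ x)) volume :=
    hk.sub hcont.locallyIntegrable
  have hzero := ae_eq_zero_of_forall_setIntegral_isCompact_eq_zero' hloc ?_
  · filter_upwards [hzero] with x hx
    exact sub_eq_zero.1 hx
  intro K hK
  set a₁ := (∫ x in K, w₁ x) / n₁ with ha₁
  set a₂ := (∫ x in K, w₂ x) / n₂ with ha₂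
  -- The indicator of `K`, corrected on `I` to be orthogonal to `w₁` and `w₂`. Testing `k` against
  -- it is the same as integrating `k - c₁ w₁ - c₂ w₂` over `K`.
  let f : ℝ → ℂ := fun x => K.indicator (fun _ => 1) x - I.indicator (fun x => a₁ * w₁ x) x -
    I.indicator (fun x => a₂ * w₂ x) x
  have hIc : IsCompact I := isCompact_Icc
  have hmem {S : Set ℝ} (hS : IsCompact S) {g : ℝ → ℂ} (hg : Continuous g) :
      MemLp (S.indicator g) 2 volume := by
    rw [memLp_indicator_iff_restrict hS.measurableSet,
      memLp_two_iff_integrable_sq_norm hg.aestronglyMeasurable]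
    exact (hg.norm.pow 2).continuousOn.integrableOn_compact hS
  have hfL : MemLp f 2 volume :=
    ((hmem hK continuous_const).sub (hmem hIc (continuous_const.mul hw.continuous₁))).sub
      (hmem hIc (continuous_const.mul hw.continuous₂))
  obtain ⟨R, hR⟩ : ∃ R, ∀ x, R < |x| → f x = 0 := by
    obtain ⟨R, hR⟩ := (hK.union hIc).isBounded.exists_norm_le
    refine ⟨R, fun x hx => ?_⟩
    have hx' : x ∉ K ∪ I := fun h => absurd (hR x h) (not_le.2 hx)
    rw [mem_union, not_or] at hx'
    simp [f, hx'.1, hx'.2]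
  have hpair {g : ℝ → ℂ} (hg : LocallyIntegrable g volume) :
      ∫ x, g x * f x = (∫ x in K, g x) - a₁ * (∫ x in I, g x * w₁ x)
        - a₂ * ∫ x in I, g x * w₂ x := by
    have e : (fun x => g x * f x) = fun x => K.indicator g x
        - I.indicator (fun x => a₁ * (g x * w₁ x)) x
        - I.indicator (fun x => a₂ * (g x * w₂ x)) x := by
      ext x
      simp only [f, indicator]
      split_ifs <;> ring
    have i0 : Integrable (K.indicator g) volume :=
      (hg.integrableOn_isCompact hK).integrable_indicator hK.measurableSet
    have i1 {w : ℝ → ℂ} (hwc : Continuous w) (a : ℂ) :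
        Integrable (I.indicator fun x => a * (g x * w x)) volume :=
      IntegrableOn.integrable_indicator (Integrable.const_mul
        ((hg.integrableOn_isCompact hIc).mul_continuousOn hwc.continuousOn hIc) a)
        hIc.measurableSet
    rw [e, integral_sub (f := fun x => K.indicator g x - I.indicator (fun x => a₁ * (g x * w₁ x)) x)
        (i0.sub (i1 hw.continuous₁ a₁)) (i1 hw.continuous₂ a₂),
      integral_sub i0 (i1 hw.continuous₁ a₁), integral_indicator hK.measurableSet,
      integral_indicator hIc.measurableSet, integral_indicator hIc.measurableSet,
      integral_const_mul, integral_const_mul]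
  have e1 : ∫ x, w₁ x * f x = 0 := by
    rw [hpair hw.continuous₁.locallyIntegrable, h12, ← hn₁, ha₁]
    field_simp
    ring
  have e2 : ∫ x, w₂ x * f x = 0 := by
    rw [hpair hw.continuous₂.locallyIntegrable, h21, ← hn₂, ha₂]
    field_simp
    ring
  have e3 := H f R hfL hR e1 e2
  rw [hpair hk] at e3
  have j1 : IntegrableOn (fun x => c₁ * w₁ x) K :=
    (continuous_const.mul hw.continuous₁).continuousOn.integrableOn_compact hK
  have j2 : IntegrableOn (fun x => c₂ * w₂ x) K :=
    (continuous_const.mul hw.continuous₂).continuousOn.integrableOn_compact hK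
  rw [integral_sub (hk.integrableOn_isCompact hK) (hcont.continuousOn.integrableOn_compact hK),
    integral_add j1 j2, integral_const_mul, integral_const_mul]
  rw [← e3, hc₁, hc₂, ha₁, ha₂]
  ring

/-- The hard inclusion `A₀* ⊆ A_max`: if `u` is a particular solution of `τ_q u = h`, then `g - u`
annihilates the range of `A₀`, hence is a combination of `w₁` and `w₂`. Square integrability of `u`
itself is not needed, only that of `g`. -/
theorem exists_maxDomain_of_forall_inner_eq {g h : L2}
    (H : ∀ y ∈ compactDomain q, inner ℂ g (tauL2 q y) = inner ℂ h (toL2 q y)) :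
    ∃ u : maxDomain q, toL2 q u = g ∧ tauL2 q u = h := by
  have hgL := Lp.memLp g
  have hhL := Lp.memLp h
  obtain ⟨hreg, htau⟩ :=
    hw.variation_of_constants (hhL.locallyIntegrable (by norm_num)) 0
  set u : ℝ → ℂ := fun x => w₁ x * (∫ t in (0 : ℝ)..x, w₂ t * h t) -
    w₂ x * ∫ t in (0 : ℝ)..x, w₁ t * h t with hu
  have huc : Continuous u := hreg.differentiable.continuous
  have hk : LocallyIntegrable (fun x => conj (g x - u x)) volume := by
    have h1 : LocallyIntegrable (fun x => conj (g x)) volume :=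
      hgL.star.locallyIntegrable (by norm_num)
    have h2 : LocallyIntegrable (fun x => conj (u x)) volume :=
      (Complex.continuous_conj.comp huc).locallyIntegrable
    simp only [map_sub]
    exact h1.sub h2
  suffices hann : ∃ c₁ c₂ : ℂ, (fun x => conj (g x - u x)) =ᵐ[volume]
      fun x => c₁ * w₁ x + c₂ * w₂ x by
    obtain ⟨c₁, c₂, hc⟩ := hann
    set z : ℝ → ℂ := u + (conj c₁ • w₁ + conj c₂ • w₂) with hz
    have hsol : IsSolution q 0 (conj c₁ • w₁ + conj c₂ • w₂) :=
      (hw.sol₁.smul _).add (hw.sol₂.smul _)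
    have hzreg : IsRegular z := hreg.add hsol.1
    have hzg : z =ᵐ[volume] g := by
      filter_upwards [hc] with x hx
      have hx' := congrArg conj hx
      simp only [map_add, map_mul, Complex.conj_conj, Complex.conj_eq_iff_im.2 (hw.real₁ x),
        Complex.conj_eq_iff_im.2 (hw.real₂ x)] at hx'
      simp only [hz, Pi.add_apply, Pi.smul_apply, smul_eq_mul, ← hx']
      ring
    have hzh : tau q z =ᵐ[volume] h := by
      filter_upwards [tau_add q hreg hsol.1, htau, hsol.2] with x h1 h2 h3
      rw [h1, Pi.add_apply, h2, h3, zero_mul, add_zero]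
    have hzL := (memLp_congr_ae hzg).2 hgL
    have hzT := (memLp_congr_ae hzh).2 hhL
    exact ⟨⟨z, hzreg, hzL, hzT⟩,
      ((MemLp.toLp_eq_toLp_iff hzL hgL).2 hzg).trans (Lp.toLp_coeFn g hgL),
      ((MemLp.toLp_eq_toLp_iff hzT hhL).2 hzh).trans (Lp.toLp_coeFn h hhL)⟩
  -- Each admissible test function is `τ_q y` with `y` of compact support; the Lagrange identity
  -- moves `τ_q` from `y` to `u`.
  refine hw.ae_eq_of_forall_integral_eq_zero hk fun f R hf hR h1 h2 => ?_
  obtain ⟨y, hyc, hy⟩ := hw.exists_compactDomain_tau_eq hf hR h1 h2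
  obtain ⟨hint, hL⟩ := integral_lagrange_of_hasCompactSupport q hreg y.2.1 hyc
  have hH := H y hyc
  have e1 : inner ℂ g (tauL2 q y) = ∫ x, conj (g x) * tau q y x := by
    conv_lhs => rw [← Lp.toLp_coeFn g hgL]
    exact inner_toLp hgL y.2.2.2
  have e2 : inner ℂ h (toL2 q y) = ∫ x, conj (h x) * (y : ℝ → ℂ) x := by
    conv_lhs => rw [← Lp.toLp_coeFn h hhL]
    exact inner_toLp hhL y.2.2.1
  rw [e1, e2] at hH
  have i1 := integrable_conj_mul hgL y.2.2.2
  have i2 := integrable_conj_mul hhL y.2.2.1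
  calc ∫ x, conj (g x - u x) * f x
      = ∫ x, ((conj (g x) * tau q y x - conj (h x) * (y : ℝ → ℂ) x)
          + (conj (tau q u x) * (y : ℝ → ℂ) x - conj (u x) * tau q y x)) := by
        refine integral_congr_ae ?_
        filter_upwards [hy, htau] with x hx hx'
        rw [hx, hx', map_sub]
        ring
    _ = 0 := by
        rw [integral_add (f := fun x => conj (g x) * tau q y x - conj (h x) * (y : ℝ → ℂ) x)
          (i1.sub i2) hint, integral_sub i1 i2, hL, hH]
        simp

end IsBoundaryPair

/-! ### Adjoints and the domain of the minimal operator. -/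

/-- The adjoint of a graph is its orthogonal complement rotated by `(a, b) ↦ (b, -a)`. Two rotations
give `-1`, so the double adjoint is the double orthogonal complement, which is the closure. The
`WithLp 2` product supplies the inner product. -/
theorem mem_topologicalClosure_of_mem_adjoint_adjoint {E F : Type*} [NormedAddCommGroup E]
    [InnerProductSpace ℂ E] [CompleteSpace E] [NormedAddCommGroup F] [InnerProductSpace ℂ F]
    [CompleteSpace F] {G : Submodule ℂ (E × F)} {p : E × F} (hp : p ∈ G.adjoint.adjoint) :
    p ∈ G.topologicalClosure := by
  let e := WithLp.linearEquiv 2 ℂ (E × F)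
  let G' : Submodule ℂ (WithLp 2 (E × F)) := G.map e.symm.toLinearMap
  have h1 : e.symm p ∈ G'ᗮᗮ := by
    rw [Submodule.mem_orthogonal]
    intro x hx
    have hx' : ((e x).2, -(e x).1) ∈ G.adjoint := by
      rw [Submodule.mem_adjoint_iff]
      intro a b hab
      have := (Submodule.mem_orthogonal _ _).1 hx (e.symm (a, b))
        (Submodule.mem_map_of_mem hab)
      rw [WithLp.prod_inner_apply] at this
      rw [inner_neg_right, sub_neg_eq_add, add_comm]
      exact this
    have := (Submodule.mem_adjoint_iff _ _).1 hp _ _ hx'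
    rw [WithLp.prod_inner_apply]
    rw [inner_neg_left, ← neg_add', neg_eq_zero] at this
    exact this
  rw [Submodule.orthogonal_orthogonal_eq_closure] at h1
  have h2 : p ∈ closure (Set.image e (G' : Set (WithLp 2 (E × F)))) :=
    image_closure_subset_closure_image (WithLp.prod_continuous_ofLp 2 E F)
      ⟨e.symm p, h1, e.apply_symm_apply p⟩
  have h3 : Set.image e (G' : Set (WithLp 2 (E × F))) = G := by
    ext x
    constructor
    · rintro ⟨_, ⟨y, hy, rfl⟩, rfl⟩
      exact hy
    · exact fun hx => ⟨e.symm x, ⟨x, hx, rfl⟩, e.apply_symm_apply x⟩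
  rw [h3] at h2
  exact h2

section Operators

variable {q : ℝ → ℝ}

theorem maxOp_apply (y : maxDomain q) (h : toL2 q y ∈ (maxOp q).domain) :
    maxOp q ⟨toL2 q y, h⟩ = tauL2 q y := by
  have : (LinearEquiv.ofInjective (toL2 q) (toL2_injective q)).symm ⟨toL2 q y, h⟩ = y :=
    (LinearEquiv.symm_apply_eq _).2 rfl
  exact congrArg (tauL2 q) this

theorem mem_maxOp_graph {p : L2 × L2} :
    p ∈ (maxOp q).graph ↔ ∃ y : maxDomain q, toL2 q y = p.1 ∧ tauL2 q y = p.2 := by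
  rw [LinearPMap.mem_graph_iff]
  constructor
  · rintro ⟨⟨_, ⟨y, rfl⟩⟩, h1, h2⟩
    exact ⟨y, h1, (maxOp_apply y ⟨y, rfl⟩).symm.trans h2⟩
  · rintro ⟨y, h1, h2⟩
    exact ⟨⟨toL2 q y, y, rfl⟩, h1, (maxOp_apply y ⟨y, rfl⟩).trans h2⟩

theorem mem_preMinOp_graph {p : L2 × L2} :
    p ∈ (preMinOp q).graph ↔ ∃ y ∈ compactDomain q, toL2 q y = p.1 ∧ tauL2 q y = p.2 := by
  rw [LinearPMap.mem_graph_iff]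
  constructor
  · rintro ⟨⟨_, ⟨⟨y, hy, rfl⟩, h⟩⟩, h1, h2⟩
    exact ⟨y, hy, h1, (maxOp_apply y h).symm.trans h2⟩
  · rintro ⟨y, hy, h1, h2⟩
    exact ⟨⟨toL2 q y, ⟨y, hy, rfl⟩, y, rfl⟩, h1, (maxOp_apply y ⟨y, rfl⟩).trans h2⟩

theorem toL2_mem_preMinOp_domain {y : maxDomain q} (hy : y ∈ compactDomain q) :
    toL2 q y ∈ (preMinOp q).domain := ⟨⟨y, hy, rfl⟩, y, rfl⟩

theorem preMinOp_le_maxOp : preMinOp q ≤ maxOp q := LinearPMap.domRestrict_le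

variable {w₁ w₂ : ℝ → ℂ} (hw : IsBoundaryPair q w₁ w₂)
include hw

/-- If `h` is orthogonal to the domain, then `(0, h)` satisfies the adjoint relation, so `h = τ_q u`
with `u = 0`. -/
theorem dense_preMinOp_domain : Dense ((preMinOp q).domain : Set L2) := by
  rw [Submodule.dense_iff_topologicalClosure_eq_top, Submodule.topologicalClosure_eq_top_iff,
    Submodule.eq_bot_iff]
  intro h hh
  rw [Submodule.mem_orthogonal'] at hh
  obtain ⟨u, hu, hu'⟩ := hw.exists_maxDomain_of_forall_inner_eq (g := 0) (h := h) fun y hy => by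
    rw [hh _ (toL2_mem_preMinOp_domain hy), inner_zero_left]
  have : u = 0 := toL2_injective q (hu.trans (map_zero _).symm)
  rw [← hu', this, map_zero]

theorem adjoint_preMinOp_graph : (preMinOp q).graph.adjoint = (maxOp q).graph := by
  ext ⟨g, h⟩
  rw [Submodule.mem_adjoint_iff, mem_maxOp_graph]
  constructor
  · intro H
    refine hw.exists_maxDomain_of_forall_inner_eq fun y hy => ?_
    have := sub_eq_zero.1 (H _ _ (mem_preMinOp_graph.2 ⟨y, hy, rfl, rfl⟩))
    rw [← inner_conj_symm, this, inner_conj_symm]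
  · rintro ⟨u, rfl, rfl⟩ a b hab
    obtain ⟨y, hy, rfl, rfl⟩ := mem_preMinOp_graph.1 hab
    have h1 := integral_lagrange_of_hasCompactSupport q u.2.1 y.2.1 hy
    have h2 : inner ℂ (tauL2 q u) (toL2 q y) - inner ℂ (toL2 q u) (tauL2 q y) = 0 := by
      rw [← h1.2, integral_sub (integrable_conj_mul u.2.2.2 y.2.2.1)
        (integrable_conj_mul u.2.2.1 y.2.2.2), ← inner_toLp u.2.2.2 y.2.2.1,
        ← inner_toLp u.2.2.1 y.2.2.2]
      rfl
    rw [← inner_conj_symm, ← inner_conj_symm (toL2 q y), ← map_sub, ← neg_sub, h2]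
    simp

theorem adjoint_preMinOp : (preMinOp q).adjoint = maxOp q := by
  apply LinearPMap.eq_of_eq_graph
  rw [LinearPMap.adjoint_graph_eq_graph_adjoint (dense_preMinOp_domain hw),
    adjoint_preMinOp_graph hw]

theorem isClosed_maxOp : (maxOp q).IsClosed :=
  adjoint_preMinOp hw ▸ LinearPMap.adjoint_isClosed (dense_preMinOp_domain hw)

theorem minOp_graph : (minOp q).graph = (preMinOp q).graph.topologicalClosure :=
  (((isClosed_maxOp hw).isClosable.leIsClosable
    preMinOp_le_maxOp).graph_closure_eq_closure_graph).symm

theorem dense_minOp_domain : Dense ((minOp q).domain : Set L2) :=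
  (dense_preMinOp_domain hw).mono (LinearPMap.le_closure _).1

/-- Since `A_max = A₀*`, this is the statement that `A₀**` is the closure of `A₀`. -/
theorem minOp_graph_eq_adjoint : (minOp q).graph = (maxOp q).graph.adjoint := by
  rw [minOp_graph hw]
  refine le_antisymm ?_ fun p hp => ?_
  · refine Submodule.topologicalClosure_minimal _ ?_ ?_
    · intro p hp
      rw [Submodule.mem_adjoint_iff]
      intro a b hab
      rw [← adjoint_preMinOp_graph hw, Submodule.mem_adjoint_iff] at hab
      have := hab _ _ hp
      rw [← inner_conj_symm, ← inner_conj_symm a, ← map_sub, ← neg_sub, this]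
      simp
    · have : ((maxOp q).graph.adjoint : Set (L2 × L2)) =
          ⋂ z : (maxOp q).graph, {p | inner ℂ z.1.2 p.1 - inner ℂ z.1.1 p.2 = 0} := by
        ext p
        simp only [SetLike.mem_coe, Submodule.mem_adjoint_iff, mem_iInter, mem_ofPred_eq]
        exact ⟨fun h z => h _ _ z.2, fun h a b hab => h ⟨(a, b), hab⟩⟩
      rw [this]
      exact isClosed_iInter fun z => isClosed_eq (by fun_prop) continuous_const
  · rw [← adjoint_preMinOp_graph hw] at hp
    exact mem_topologicalClosure_of_mem_adjoint_adjoint hp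

theorem adjoint_minOp : (minOp q).adjoint = maxOp q := by
  apply LinearPMap.eq_of_eq_graph
  rw [LinearPMap.adjoint_graph_eq_graph_adjoint (dense_minOp_domain hw)]
  refine le_antisymm (fun p hp => ?_) fun p hp => ?_
  · rw [← adjoint_preMinOp_graph hw, Submodule.mem_adjoint_iff]
    intro a b hab
    exact (Submodule.mem_adjoint_iff _ _).1 hp a b
      (LinearPMap.le_graph_of_le (LinearPMap.le_closure _) hab)
  · rw [Submodule.mem_adjoint_iff]
    intro a b hab
    rw [minOp_graph_eq_adjoint hw, Submodule.mem_adjoint_iff] at hab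
    have := hab _ _ hp
    rw [← inner_conj_symm, ← inner_conj_symm a, ← map_sub, ← neg_sub, this]
    simp

theorem minOp_le_maxOp : minOp q ≤ maxOp q := by
  refine LinearPMap.le_of_le_graph ?_
  rw [minOp_graph hw]
  exact Submodule.topologicalClosure_minimal _ (LinearPMap.le_graph_of_le preMinOp_le_maxOp)
    (isClosed_maxOp hw)

/-- `A = A_max*`, with the pairing against each `z` rewritten by Green's formula. -/
theorem toL2_mem_minOp_domain_iff {y : maxDomain q} :
    toL2 q y ∈ (minOp q).domain ↔ ∀ z : maxDomain q, bracketTop z y = bracketBot z y := by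
  have h1 : toL2 q y ∈ (minOp q).domain ↔ (toL2 q y, tauL2 q y) ∈ (minOp q).graph := by
    constructor
    · intro h
      obtain ⟨g, hg⟩ := LinearPMap.mem_domain_iff.1 h
      obtain ⟨z, hz, hz'⟩ := mem_maxOp_graph.1 (LinearPMap.le_graph_of_le (minOp_le_maxOp hw) hg)
      obtain rfl : z = y := toL2_injective q hz
      rw [show tauL2 q z = g from hz']
      exact hg
    · exact LinearPMap.mem_domain_of_mem_graph
  rw [h1, minOp_graph_eq_adjoint hw, Submodule.mem_adjoint_iff]
  simp only [← sub_eq_zero (a := bracketTop _ _), bracketTop_sub_bracketBot]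
  constructor
  · exact fun H z => H _ _ (mem_maxOp_graph.2 ⟨z, rfl, rfl⟩)
  · rintro H a b hab
    obtain ⟨z, rfl, rfl⟩ := mem_maxOp_graph.1 hab
    exact H z

end Operators

/-! ### Cutoffs and the boundary map onto `ℂ⁴`. -/

theorem exists_smooth_cutoff : ∃ φ φ₁ φ₂ : ℝ → ℂ, (∀ x, HasDerivAt φ (φ₁ x) x) ∧
    (∀ x, HasDerivAt φ₁ (φ₂ x) x) ∧ Continuous φ₂ ∧ (∀ x, ‖φ x‖ ≤ 1) ∧
    (∀ x < 0, φ x = 0) ∧ (∀ x > 1, φ x = 1) ∧ HasCompactSupport φ₁ ∧ HasCompactSupport φ₂ := by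
  set φ : ℝ → ℂ := fun x => (Real.smoothTransition x : ℂ) with hφ
  have hsm : ContDiff ℝ 2 φ := Complex.ofRealCLM.contDiff.comp Real.smoothTransition.contDiff
  have h1 : ContDiff ℝ 1 (deriv φ) := ((contDiff_succ_iff_deriv (n := 1)).1 hsm).2.2
  have h0 : ∀ x < 0, φ x = 0 := fun x hx => by
    simp [hφ, Real.smoothTransition.zero_of_nonpos hx.le]
  have h2 : ∀ x > 1, φ x = 1 := fun x hx => by
    simp [hφ, Real.smoothTransition.one_of_one_le hx.le]
  have hd : ∀ x, x ∉ Icc (0 : ℝ) 1 → φ =ᶠ[𝓝 x] fun _ => φ x := fun x hx => by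
    rw [mem_Icc, not_and_or, not_le, not_le] at hx
    rcases hx with hx | hx
    · filter_upwards [Iio_mem_nhds hx] with y hy
      rw [h0 y hy, h0 x hx]
    · filter_upwards [Ioi_mem_nhds hx] with y hy
      rw [h2 y hy, h2 x hx]
  have hc : HasCompactSupport (deriv φ) :=
    HasCompactSupport.intro isCompact_Icc fun x hx => by rw [(hd x hx).deriv_eq, deriv_const]
  refine ⟨φ, deriv φ, deriv (deriv φ), fun x => (hsm.differentiable (by norm_num) x).hasDerivAt,
    fun x => (h1.differentiable (by norm_num) x).hasDerivAt, h1.continuous_deriv le_rfl,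
    fun x => ?_, h0, h2, hc, hc.deriv⟩
  rw [hφ, Complex.norm_real, Real.norm_of_nonneg (Real.smoothTransition.nonneg x)]
  exact Real.smoothTransition.le_one x

/-- This decouples the two ends. The commutator of `τ_q` with the cutoff is continuous with compact
support, so the product stays in `D_max`. -/
theorem exists_maxDomain_cutoff {q : ℝ → ℝ} (y : maxDomain q) :
    ∃ z : maxDomain q, (∀ x > 1, (z : ℝ → ℂ) x = (y : ℝ → ℂ) x) ∧
      ∀ x < 0, (z : ℝ → ℂ) x = 0 := by
  obtain ⟨φ, φ₁, φ₂, h1, h2, h3, h4, h5, h6, h7, h8⟩ := exists_smooth_cutoff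
  obtain ⟨y, hy, hyL, hyT⟩ := y
  have c1 : Continuous φ := continuous_iff_continuousAt.2 fun x => (h1 x).continuousAt
  have c2 : Continuous φ₁ := continuous_iff_continuousAt.2 fun x => (h2 x).continuousAt
  have a1 : ACLoc φ := ACLoc.of_hasDerivAt h1 c2
  have a2 : ACLoc φ₁ := ACLoc.of_hasDerivAt h2 h3
  have hyc := hy.differentiable.continuous
  have hyc' := hy.acLoc_deriv.continuous
  set v : ℝ → ℂ := fun x => φ₁ x * y x + φ x * deriv y x with hv
  have hd : ∀ x, HasDerivAt (fun x => φ x * y x) (v x) x := fun x =>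
    (h1 x).mul (hy.differentiable x).hasDerivAt
  have hreg : IsRegular fun x => φ x * y x :=
    IsRegular.of_hasDerivAt hd ((a2.mul hy.acLoc).add (a1.mul hy.acLoc_deriv))
  have htau : tau q (fun x => φ x * y x) =ᵐ[volume]
      fun x => φ x * tau q y x - (φ₂ x * y x + 2 * φ₁ x * deriv y x) := by
    filter_upwards [hy.acLoc_deriv.ae_differentiableAt] with x hx
    have hdv : HasDerivAt v (φ₂ x * y x + 2 * φ₁ x * deriv y x + φ x * deriv (deriv y) x) x :=
      (((h2 x).mul (hy.differentiable x).hasDerivAt).add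
        ((h1 x).mul hx.hasDerivAt)).congr_deriv (by ring)
    have hd' : deriv (fun x => φ x * y x) = v := funext fun x => (hd x).deriv
    rw [tau, hd', hdv.deriv, tau]
    ring
  have hbdd {f : ℝ → ℂ} (hf : MemLp f 2 volume) : MemLp (fun x => φ x * f x) 2 volume :=
    hf.of_le (c1.aestronglyMeasurable.mul hf.1) (ae_of_all _ fun x => by
      rw [norm_mul]
      exact mul_le_of_le_one_left (norm_nonneg _) (h4 x))
  have hcomp : MemLp (fun x => φ₂ x * y x + 2 * φ₁ x * deriv y x) 2 volume :=
    Continuous.memLp_of_hasCompactSupport (by fun_prop)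
      ((h8.mul_right (f' := y)).add ((h7.mul_left (f := fun _ => 2)).mul_right (f' := deriv y)))
  refine ⟨⟨fun x => φ x * y x, hreg, hbdd hyL, ?_⟩, fun x hx => ?_, fun x hx => ?_⟩
  · exact (memLp_congr_ae htau).2 ((hbdd hyT).sub hcomp)
  · change φ x * y x = y x
    rw [h6 x hx, one_mul]
  · change φ x * y x = 0
    rw [h5 x hx, zero_mul]

theorem bracketTop_congr {f f' g g' : ℝ → ℂ} {a : ℝ} (hf : ∀ x > a, f x = f' x)
    (hg : ∀ x > a, g x = g' x) : bracketTop f g = bracketTop f' g' := by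
  refine congrArg lim (Filter.map_congr ?_)
  filter_upwards [eventually_gt_atTop a] with x hx
  have h1 : f =ᶠ[𝓝 x] f' := by filter_upwards [Ioi_mem_nhds hx] with y hy using hf y hy
  have h2 : g =ᶠ[𝓝 x] g' := by filter_upwards [Ioi_mem_nhds hx] with y hy using hg y hy
  rw [bracket, bracket, h1.deriv_eq, h2.deriv_eq, hf x hx, hg x hx]

theorem bracketBot_congr {f f' g g' : ℝ → ℂ} {a : ℝ} (hf : ∀ x < a, f x = f' x)
    (hg : ∀ x < a, g x = g' x) : bracketBot f g = bracketBot f' g' := by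
  refine congrArg lim (Filter.map_congr ?_)
  filter_upwards [eventually_lt_atBot a] with x hx
  have h1 : f =ᶠ[𝓝 x] f' := by filter_upwards [Iio_mem_nhds hx] with y hy using hf y hy
  have h2 : g =ᶠ[𝓝 x] g' := by filter_upwards [Iio_mem_nhds hx] with y hy using hg y hy
  rw [bracket, bracket, h1.deriv_eq, h2.deriv_eq, hf x hx, hg x hx]

section Linear

variable {q : ℝ → ℝ}

theorem bracket_add {f g : ℝ → ℂ} (w : ℝ → ℂ) (hf : IsRegular f) (hg : IsRegular g) (x : ℝ) :
    bracket w (f + g) x = bracket w f x + bracket w g x := by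
  simp only [bracket, deriv_add (hf.differentiable x) (hg.differentiable x), Pi.add_apply]
  ring

theorem bracket_smul {f : ℝ → ℂ} (w : ℝ → ℂ) (c : ℂ) (hf : IsRegular f) (x : ℝ) :
    bracket w (c • f) x = c * bracket w f x := by
  simp only [bracket, deriv_const_smul c (hf.differentiable x), Pi.smul_apply, smul_eq_mul]
  ring

/-- `f ↦ [w,f]_∞` as a linear functional on the maximal domain. -/
def bracketTopLM (w : maxDomain q) : maxDomain q →ₗ[ℂ] ℂ where
  toFun f := bracketTop w f
  map_add' f g := tendsto_nhds_unique (tendsto_bracketTop w (f + g))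
    (((tendsto_bracketTop w f).add (tendsto_bracketTop w g)).congr fun x =>
      (bracket_add _ f.2.1 g.2.1 x).symm)
  map_smul' c f := tendsto_nhds_unique (tendsto_bracketTop w (c • f))
    (((tendsto_bracketTop w f).const_mul c).congr fun x => (bracket_smul _ c f.2.1 x).symm)

/-- `f ↦ [w,f]_{-∞}` as a linear functional on the maximal domain. -/
def bracketBotLM (w : maxDomain q) : maxDomain q →ₗ[ℂ] ℂ where
  toFun f := bracketBot w f
  map_add' f g := tendsto_nhds_unique (tendsto_bracketBot w (f + g))
    (((tendsto_bracketBot w f).add (tendsto_bracketBot w g)).congr fun x =>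
      (bracket_add _ f.2.1 g.2.1 x).symm)
  map_smul' c f := tendsto_nhds_unique (tendsto_bracketBot w (c • f))
    (((tendsto_bracketBot w f).const_mul c).congr fun x => (bracket_smul _ c f.2.1 x).symm)

theorem bracketBot_zero_left (f : maxDomain q) : bracketBot 0 f = 0 := by
  have h : bracket 0 (f : ℝ → ℂ) = fun _ => 0 := by
    ext x
    simp [bracket, show deriv (0 : ℝ → ℂ) = 0 from funext fun x => by simp]
  have := tendsto_bracketBot (0 : maxDomain q) f
  rw [Submodule.coe_zero, h] at this
  exact tendsto_nhds_unique this tendsto_const_nhds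

end Linear

namespace IsBoundaryPair

variable {q : ℝ → ℝ} {w₁ w₂ : ℝ → ℂ} (hw : IsBoundaryPair q w₁ w₂)

/-- The boundary values `(α₁(f), α₂(f), β₁(f), β₂(f))`. -/
def boundaryMap : maxDomain q →ₗ[ℂ] (Fin 4 → ℂ) :=
  LinearMap.pi ![bracketBotLM ⟨w₁, hw.mem₁⟩, bracketBotLM ⟨w₂, hw.mem₂⟩,
    bracketTopLM ⟨w₁, hw.mem₁⟩, bracketTopLM ⟨w₂, hw.mem₂⟩]

theorem boundaryMap_apply (f : maxDomain q) : hw.boundaryMap f =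
    ![bracketBot w₁ f, bracketBot w₂ f, bracketTop w₁ f, bracketTop w₂ f] := by
  ext i
  fin_cases i <;> rfl

include hw

/-- A `2 × 2` determinant identity, using that the Wronskian is `1`. In the limit, all boundary
brackets are determined by those with `w₁` and `w₂`. -/
theorem bracket_plucker (f g : ℝ → ℂ) (x : ℝ) :
    bracket g f x = conj (bracket w₁ g x) * bracket w₂ f x -
      conj (bracket w₂ g x) * bracket w₁ f x := by
  have h := hw.wronskian x
  have c₁ := Complex.conj_eq_iff_im.2 (hw.real₁ x)
  have c₂ := Complex.conj_eq_iff_im.2 (hw.real₂ x)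
  have d₁ := conj_deriv_of_real hw.real₁ x
  have d₂ := conj_deriv_of_real hw.real₂ x
  simp only [bracket, map_sub, map_mul, c₁, c₂, d₁, d₂]
  linear_combination
    -(conj (g x) * deriv f x - conj (deriv g x) * f x) * h

theorem toL2_mem_minOp_domain_iff_boundaryMap {y : maxDomain q} :
    toL2 q y ∈ (minOp q).domain ↔ hw.boundaryMap y = 0 := by
  rw [toL2_mem_minOp_domain_iff hw]
  constructor
  · intro h
    -- The cutoff of `w` has bracket zero at `-∞`, hence also at `∞`, where it agrees with `w`;
    -- applying the hypothesis to `w` itself then settles `-∞`.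
    have key (w : maxDomain q) : bracketTop w y = 0 ∧ bracketBot w y = 0 := by
      obtain ⟨z, hz1, hz0⟩ := exists_maxDomain_cutoff w
      have h1 : bracketTop w y = bracketTop z y :=
        bracketTop_congr (fun x hx => (hz1 x hx).symm) fun _ _ => rfl
      have h2 : bracketBot z y = 0 :=
        (bracketBot_congr (f' := 0) hz0 fun _ _ => rfl).trans (bracketBot_zero_left y)
      have h3 : bracketTop w y = 0 := by rw [h1, h z, h2]
      exact ⟨h3, by rw [← h w, h3]⟩
    rw [boundaryMap_apply, (key ⟨w₁, hw.mem₁⟩).1, (key ⟨w₁, hw.mem₁⟩).2,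
      (key ⟨w₂, hw.mem₂⟩).1, (key ⟨w₂, hw.mem₂⟩).2]
    ext i
    fin_cases i <;> rfl
  · intro h z
    rw [boundaryMap_apply] at h
    have hb1 : bracketBot w₁ y = 0 := congrFun h 0
    have hb2 : bracketBot w₂ y = 0 := congrFun h 1
    have ht1 : bracketTop w₁ y = 0 := congrFun h 2
    have ht2 : bracketTop w₂ y = 0 := congrFun h 3
    have conjT {F : Filter ℝ} {f : ℝ → ℂ} {c : ℂ} (hf : Tendsto f F (𝓝 c)) :
        Tendsto (fun x => conj (f x)) F (𝓝 (conj c)) := (Complex.continuous_conj.tendsto c).comp hf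
    have e1 : bracketTop z y = 0 := by
      have t1 := tendsto_bracketTop ⟨w₁, hw.mem₁⟩ y
      have t2 := tendsto_bracketTop ⟨w₂, hw.mem₂⟩ y
      have s1 := conjT (tendsto_bracketTop ⟨w₁, hw.mem₁⟩ z)
      have s2 := conjT (tendsto_bracketTop ⟨w₂, hw.mem₂⟩ z)
      have := (s1.mul t2).sub (s2.mul t1)
      simp only [ht1, ht2, mul_zero, sub_zero] at this
      exact tendsto_nhds_unique (tendsto_bracketTop z y)
        (this.congr fun x => (hw.bracket_plucker y z x).symm)
    have e2 : bracketBot z y = 0 := by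
      have t1 := tendsto_bracketBot ⟨w₁, hw.mem₁⟩ y
      have t2 := tendsto_bracketBot ⟨w₂, hw.mem₂⟩ y
      have s1 := conjT (tendsto_bracketBot ⟨w₁, hw.mem₁⟩ z)
      have s2 := conjT (tendsto_bracketBot ⟨w₂, hw.mem₂⟩ z)
      have := (s1.mul t2).sub (s2.mul t1)
      simp only [hb1, hb2, mul_zero, sub_zero] at this
      exact tendsto_nhds_unique (tendsto_bracketBot z y)
        (this.congr fun x => (hw.bracket_plucker y z x).symm)
    rw [e1, e2]

theorem bracket_antisymm (x : ℝ) : bracket w₂ w₁ x = -bracket w₁ w₂ x := by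
  rw [bracket_of_real hw.real₁, bracket_of_real hw.real₂]
  ring

theorem boundaryMap_surjective : Function.Surjective hw.boundaryMap := by
  set v₁ : maxDomain q := ⟨w₁, hw.mem₁⟩ with hv₁
  set v₂ : maxDomain q := ⟨w₂, hw.mem₂⟩ with hv₂
  obtain ⟨z₁, hz₁, hz₁'⟩ := exists_maxDomain_cutoff v₁
  obtain ⟨z₂, hz₂, hz₂'⟩ := exists_maxDomain_cutoff v₂
  have hneg {F : Filter ℝ} (h : Tendsto (bracket w₁ w₂) F (𝓝 1)) :
      Tendsto (bracket w₂ w₁) F (𝓝 (-1)) := by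
    rw [funext hw.bracket_antisymm]; exact h.neg
  have b11 : bracketBot w₁ w₁ = 0 := hw.bot₁₁.limUnder_eq
  have b12 : bracketBot w₁ w₂ = 1 := hw.bot₁₂.limUnder_eq
  have b21 : bracketBot w₂ w₁ = -1 := (hneg hw.bot₁₂).limUnder_eq
  have b22 : bracketBot w₂ w₂ = 0 := hw.bot₂₂.limUnder_eq
  have t11 : bracketTop w₁ w₁ = 0 := hw.top₁₁.limUnder_eq
  have t12 : bracketTop w₁ w₂ = 1 := hw.top₁₂.limUnder_eq
  have t21 : bracketTop w₂ w₁ = -1 := (hneg hw.top₁₂).limUnder_eq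
  have t22 : bracketTop w₂ w₂ = 0 := hw.top₂₂.limUnder_eq
  have hT {w : ℝ → ℂ} {z v : maxDomain q} (h : ∀ x > 1, (z : ℝ → ℂ) x = (v : ℝ → ℂ) x) :
      bracketTop w z = bracketTop w v := bracketTop_congr (fun _ _ => rfl) h
  have hB (w z : maxDomain q) (h : ∀ x < 0, (z : ℝ → ℂ) x = 0) : bracketBot w z = 0 :=
    (bracketBot_congr (g' := (0 : maxDomain q)) (fun _ _ => rfl) h).trans
      (map_zero (bracketBotLM w))
  have m1 : hw.boundaryMap v₁ = ![0, -1, 0, -1] := by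
    rw [boundaryMap_apply]; simp only [hv₁, b11, b21, t11, t21]
  have m2 : hw.boundaryMap v₂ = ![1, 0, 1, 0] := by
    rw [boundaryMap_apply]; simp only [hv₂, b12, b22, t12, t22]
  have m3 : hw.boundaryMap z₁ = ![0, 0, 0, -1] := by
    rw [boundaryMap_apply, hT hz₁, hT hz₁, hB v₁ z₁ hz₁', hB v₂ z₁ hz₁']
    simp only [hv₁, t11, t21]
  have m4 : hw.boundaryMap z₂ = ![0, 0, 1, 0] := by
    rw [boundaryMap_apply, hT hz₂, hT hz₂, hB v₁ z₂ hz₂', hB v₂ z₂ hz₂']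
    simp only [hv₂, t12, t22]
  intro s
  -- The boundary values of `v₂ - z₂`, `v₁ - z₁`, `z₂`, `z₁` are `e₀`, `-e₁`, `e₂`, `-e₃`.
  refine ⟨s 2 • z₂ - s 3 • z₁ + s 0 • (v₂ - z₂) - s 1 • (v₁ - z₁), ?_⟩
  simp only [map_add, map_sub, map_smul, m1, m2, m3, m4]
  ext i
  fin_cases i <;> simp

end IsBoundaryPair

/-! ### Bi-extensions as hyperplanes of boundary values, and their eigenvalues. -/

theorem linearPMap_le_of_domain_le {S T U : L2 →ₗ.[ℂ] L2} (hS : S ≤ U) (hT : T ≤ U)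
    (h : S.domain ≤ T.domain) : S ≤ T :=
  ⟨h, fun x _ hxy =>
    (hS.2 (y := ⟨x, hS.1 x.2⟩) rfl).trans (hT.2 (y := ⟨x, hS.1 x.2⟩) hxy.symm).symm⟩

theorem apply_eq_tauL2 {q : ℝ → ℝ} {T : L2 →ₗ.[ℂ] L2} (hT : T ≤ maxOp q) (y : maxDomain q)
    (h : toL2 q y ∈ T.domain) : T ⟨toL2 q y, h⟩ = tauL2 q y :=
  (hT.2 (y := ⟨toL2 q y, hT.1 h⟩) rfl).trans (maxOp_apply y _)

/-- With `w` cut off near `-∞`, Green's formula expresses the bracket at `∞` by inner products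
alone. Boundary conditions therefore cut out closed subsets of the graph of `A_max`. -/
theorem exists_continuous_bracketTop_eq {q : ℝ → ℝ} (w : maxDomain q) :
    ∃ B : L2 × L2 → ℂ, Continuous B ∧
      ∀ y : maxDomain q, bracketTop w y = B (toL2 q y, tauL2 q y) := by
  obtain ⟨z, hz1, hz0⟩ := exists_maxDomain_cutoff w
  refine ⟨fun p => inner ℂ (tauL2 q z) p.1 - inner ℂ (toL2 q z) p.2, by fun_prop, fun y => ?_⟩
  have h1 : bracketTop w y = bracketTop z y :=
    bracketTop_congr (fun x hx => (hz1 x hx).symm) fun _ _ => rfl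
  have h2 : bracketBot z y = 0 :=
    (bracketBot_congr (f' := 0) hz0 fun _ _ => rfl).trans (bracketBot_zero_left y)
  dsimp only
  rw [h1, ← bracketTop_sub_bracketBot, h2, sub_zero]

theorem exists_continuous_bracketBot_eq {q : ℝ → ℝ} (w : maxDomain q) :
    ∃ B : L2 × L2 → ℂ, Continuous B ∧
      ∀ y : maxDomain q, bracketBot w y = B (toL2 q y, tauL2 q y) := by
  obtain ⟨B, hB, h⟩ := exists_continuous_bracketTop_eq w
  refine ⟨fun p => B p - (inner ℂ (tauL2 q w) p.1 - inner ℂ (toL2 q w) p.2), by fun_prop,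
    fun y => ?_⟩
  dsimp only
  rw [← h, ← bracketTop_sub_bracketBot]
  ring

/-- The functional `s ↦ a s₀ + b s₁ - c s₂ - d s₃` on boundary values. -/
def boundaryFunctional (a b c d : ℂ) : (Fin 4 → ℂ) →ₗ[ℂ] ℂ :=
  a • LinearMap.proj 0 + b • LinearMap.proj 1 - c • LinearMap.proj 2 - d • LinearMap.proj 3

theorem boundaryFunctional_apply (a b c d : ℂ) (s : Fin 4 → ℂ) :
    boundaryFunctional a b c d s = a * s 0 + b * s 1 - c * s 2 - d * s 3 := rfl

theorem eq_boundaryFunctional (φ : (Fin 4 → ℂ) →ₗ[ℂ] ℂ) :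
    φ = boundaryFunctional (φ (Pi.single 0 1)) (φ (Pi.single 1 1)) (-φ (Pi.single 2 1))
      (-φ (Pi.single 3 1)) := by
  refine LinearMap.pi_ext' fun i => LinearMap.ext_ring ?_
  fin_cases i <;> simp [boundaryFunctional_apply]

theorem boundaryFunctional_eq_zero_iff {a b c d : ℂ} :
    boundaryFunctional a b c d = 0 ↔ a = 0 ∧ b = 0 ∧ c = 0 ∧ d = 0 := by
  constructor
  · intro h
    have h0 := LinearMap.congr_fun h (Pi.single 0 1)
    have h1 := LinearMap.congr_fun h (Pi.single 1 1)
    have h2 := LinearMap.congr_fun h (Pi.single 2 1)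
    have h3 := LinearMap.congr_fun h (Pi.single 3 1)
    simp [boundaryFunctional_apply] at h0 h1 h2 h3
    exact ⟨h0, h1, h2, h3⟩
  · rintro ⟨rfl, rfl, rfl, rfl⟩
    ext
    simp [boundaryFunctional_apply]

theorem finrank_ker_of_ne_zero {φ : (Fin 4 → ℂ) →ₗ[ℂ] ℂ} (h : φ ≠ 0) :
    Module.finrank ℂ (LinearMap.ker φ) = 3 := by
  have := Module.Dual.finrank_ker_add_one_of_ne_zero (f := φ) h
  simpa using this

section PullBack

variable {q : ℝ → ℝ} {T : L2 →ₗ.[ℂ] L2} (hT : T ≤ maxOp q)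

/-- The regular representative of an element of the domain of a restriction of `A_max`. -/
def representative : T.domain →ₗ[ℂ] maxDomain q :=
  (LinearEquiv.ofInjective (toL2 q) (toL2_injective q)).symm.toLinearMap ∘ₗ
    Submodule.inclusion hT.1

theorem toL2_representative (f : T.domain) : toL2 q (representative hT f) = f :=
  congrArg Subtype.val ((LinearEquiv.ofInjective (toL2 q)
    (toL2_injective q)).apply_symm_apply (Submodule.inclusion hT.1 f))

theorem representative_toL2 (y : maxDomain q) (h : toL2 q y ∈ T.domain) :
    representative hT ⟨toL2 q y, h⟩ = y :=
  toL2_injective q (toL2_representative hT _)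

end PullBack

namespace IsBoundaryPair

variable {q : ℝ → ℝ} {w₁ w₂ : ℝ → ℂ} (hw : IsBoundaryPair q w₁ w₂) {T : L2 →ₗ.[ℂ] L2}

/-- The boundary values of the elements of the domain of `T`. -/
def boundaryRange (hT : T ≤ maxOp q) : Submodule ℂ (Fin 4 → ℂ) :=
  LinearMap.range (hw.boundaryMap ∘ₗ representative hT)

include hw

theorem rank_quotient (hT : T ≤ maxOp q) :
    Module.rank ℂ (T.domain ⧸ (minOp q).domain.submoduleOf T.domain) =
      (Module.finrank ℂ (hw.boundaryRange hT) : Cardinal) := by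
  have hker : (minOp q).domain.submoduleOf T.domain =
      LinearMap.ker (hw.boundaryMap ∘ₗ representative hT) := by
    ext f
    change (f : L2) ∈ (minOp q).domain ↔ _
    rw [LinearMap.mem_ker, LinearMap.comp_apply,
      ← hw.toL2_mem_minOp_domain_iff_boundaryMap, toL2_representative]
  rw [hker, Module.finrank_eq_rank]
  exact (LinearMap.quotKerEquivRange _).rank_eq

/-- `dom T` contains `dom A`, the kernel of the boundary map, so it is the full preimage of its
image. -/
theorem mem_domain_iff_boundaryMap_mem (hT : T ≤ maxOp q) (hA : minOp q ≤ T) (y : maxDomain q) :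
    toL2 q y ∈ T.domain ↔ hw.boundaryMap y ∈ hw.boundaryRange hT := by
  constructor
  · exact fun h => ⟨⟨toL2 q y, h⟩, by rw [LinearMap.comp_apply, representative_toL2]⟩
  · rintro ⟨f, hf⟩
    have h0 : hw.boundaryMap (y - representative hT f) = 0 := by
      rw [map_sub, sub_eq_zero]
      exact hf.symm
    have h1 := hA.1 (hw.toL2_mem_minOp_domain_iff_boundaryMap.2 h0)
    rw [map_sub, toL2_representative] at h1
    simpa using T.domain.add_mem h1 f.2

theorem hasBoundaryCondition_iff {a b c d : ℂ} :
    HasBoundaryCondition q w₁ w₂ a b c d T ↔ T ≤ maxOp q ∧ ∀ y : maxDomain q,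
      toL2 q y ∈ T.domain ↔ boundaryFunctional a b c d (hw.boundaryMap y) = 0 := by
  have key (y : maxDomain q) : boundaryFunctional a b c d (hw.boundaryMap y) = 0 ↔
      a * bracketBot w₁ y + b * bracketBot w₂ y = c * bracketTop w₁ y + d * bracketTop w₂ y := by
    rw [boundaryFunctional_apply, boundaryMap_apply, sub_sub, sub_eq_zero]
    rfl
  simp only [key]
  refine and_congr_right fun hT => ⟨fun h y => ?_, fun h f => ⟨fun hf => ?_, ?_⟩⟩
  · rw [h]
    exact ⟨fun ⟨z, hz, hz'⟩ => toL2_injective q hz ▸ hz', fun hy => ⟨y, rfl, hy⟩⟩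
  · obtain ⟨y, rfl⟩ := hT.1 hf
    exact ⟨y, rfl, (h y).1 hf⟩
  · rintro ⟨y, rfl, hy⟩
    exact (h y).2 hy

theorem isClosed_of_hasBoundaryCondition {a b c d : ℂ}
    (h : HasBoundaryCondition q w₁ w₂ a b c d T) : T.IsClosed := by
  obtain ⟨hT, hdom⟩ := hw.hasBoundaryCondition_iff.1 h
  obtain ⟨B₁, c₁, hB₁⟩ := exists_continuous_bracketBot_eq ⟨w₁, hw.mem₁⟩
  obtain ⟨B₂, c₂, hB₂⟩ := exists_continuous_bracketBot_eq ⟨w₂, hw.mem₂⟩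
  obtain ⟨B₃, c₃, hB₃⟩ := exists_continuous_bracketTop_eq ⟨w₁, hw.mem₁⟩
  obtain ⟨B₄, c₄, hB₄⟩ := exists_continuous_bracketTop_eq ⟨w₂, hw.mem₂⟩
  have hgraph : (T.graph : Set (L2 × L2)) = ((maxOp q).graph : Set (L2 × L2)) ∩
      {p | a * B₁ p + b * B₂ p - c * B₃ p - d * B₄ p = 0} := by
    have hval (y : maxDomain q) : boundaryFunctional a b c d (hw.boundaryMap y) =
        a * B₁ (toL2 q y, tauL2 q y) + b * B₂ (toL2 q y, tauL2 q y)
          - c * B₃ (toL2 q y, tauL2 q y) - d * B₄ (toL2 q y, tauL2 q y) := by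
      rw [← hB₁, ← hB₂, ← hB₃, ← hB₄, boundaryFunctional_apply, boundaryMap_apply]
      rfl
    ext p
    constructor
    · intro hp
      have hp' := LinearPMap.le_graph_of_le hT hp
      refine ⟨hp', ?_⟩
      obtain ⟨y, hy, hy'⟩ := mem_maxOp_graph.1 hp'
      have hyT : toL2 q y ∈ T.domain := hy ▸ LinearPMap.mem_domain_of_mem_graph hp
      have := (hdom y).1 hyT
      rw [hval, hy, hy'] at this
      exact this
    · rintro ⟨hp, hp'⟩
      obtain ⟨y, hy, hy'⟩ := mem_maxOp_graph.1 hp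
      obtain ⟨f, g⟩ := p
      dsimp only at hy hy'
      subst hy hy'
      have hyT := (hdom y).2 ((hval y).trans hp')
      exact (LinearPMap.mem_graph_iff _).2 ⟨⟨toL2 q y, hyT⟩, rfl, apply_eq_tauL2 hT y hyT⟩
  rw [LinearPMap.IsClosed, hgraph]
  exact IsClosed.inter (isClosed_maxOp hw) (isClosed_eq (by fun_prop) continuous_const)

theorem minOp_le_of_hasBoundaryCondition {a b c d : ℂ}
    (h : HasBoundaryCondition q w₁ w₂ a b c d T) : minOp q ≤ T := by
  obtain ⟨hT, hdom⟩ := hw.hasBoundaryCondition_iff.1 h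
  refine linearPMap_le_of_domain_le (minOp_le_maxOp hw) hT fun f hf => ?_
  obtain ⟨y, rfl⟩ := (minOp_le_maxOp hw).1 hf
  rw [hdom, hw.toL2_mem_minOp_domain_iff_boundaryMap.1 hf, map_zero]

/-- The quotient `dom T / dom A` is the space of boundary values of `T`, and the three-dimensional
subspaces of `ℂ⁴` are the kernels of nonzero functionals. -/
theorem isBiExtension_iff : IsBiExtension (minOp q) T 3 ↔
    ∃ a b c d : ℂ, ¬(a = 0 ∧ b = 0 ∧ c = 0 ∧ d = 0) ∧
      HasBoundaryCondition q w₁ w₂ a b c d T := by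
  rw [IsBiExtension, adjoint_minOp hw]
  constructor
  · rintro ⟨_, hA, hT, hrank⟩
    rw [hw.rank_quotient hT, Nat.cast_inj] at hrank
    have hlt : hw.boundaryRange hT < ⊤ := by
      refine lt_top_iff_ne_top.2 fun h => ?_
      rw [h, finrank_top] at hrank
      simp at hrank
    obtain ⟨φ, hφ, hle⟩ := Submodule.exists_le_ker_of_lt_top _ hlt
    have heq : hw.boundaryRange hT = LinearMap.ker φ :=
      Submodule.eq_of_le_of_finrank_eq hle (hrank.trans (finrank_ker_of_ne_zero hφ).symm)
    rw [eq_boundaryFunctional φ] at heq hφ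
    refine ⟨_, _, _, _, fun h => hφ (boundaryFunctional_eq_zero_iff.2 h),
      hw.hasBoundaryCondition_iff.2 ⟨hT, fun y => ?_⟩⟩
    rw [hw.mem_domain_iff_boundaryMap_mem hT hA, heq, LinearMap.mem_ker]
  · rintro ⟨a, b, c, d, hne, h⟩
    obtain ⟨hT, hdom⟩ := hw.hasBoundaryCondition_iff.1 h
    refine ⟨hw.isClosed_of_hasBoundaryCondition h, hw.minOp_le_of_hasBoundaryCondition h, hT, ?_⟩
    have heq : hw.boundaryRange hT = LinearMap.ker (boundaryFunctional a b c d) := by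
      ext s
      obtain ⟨y, rfl⟩ := hw.boundaryMap_surjective s
      rw [← hw.mem_domain_iff_boundaryMap_mem hT (hw.minOp_le_of_hasBoundaryCondition h), hdom,
        LinearMap.mem_ker]
    rw [hw.rank_quotient hT, heq,
      finrank_ker_of_ne_zero (mt boundaryFunctional_eq_zero_iff.1 hne)]

/-- A single boundary condition always leaves an eigenfunction in the two-dimensional solution
space of `τ_q y = l y`. -/
theorem isEigenvalue_of_hasBoundaryCondition (hq : LocallyIntegrable q volume)
    (htop : LimitCircleAtTop q) (hbot : LimitCircleAtBot q) {a b c d : ℂ}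
    (h : HasBoundaryCondition q w₁ w₂ a b c d T) (l : ℂ) : IsEigenvalue T l := by
  obtain ⟨hT, hdom⟩ := hw.hasBoundaryCondition_iff.1 h
  have hex : ∃ y : maxDomain q, y ≠ 0 ∧ IsSolution q l y ∧
      boundaryFunctional a b c d (hw.boundaryMap y) = 0 := by
    obtain ⟨u, hu, hu0, hu1⟩ := exists_isSolution hq l 1 0
    obtain ⟨v, hv, hv0, hv1⟩ := exists_isSolution hq l 0 1
    let u' : maxDomain q := ⟨u, hu.mem_maxDomain htop hbot⟩
    let v' : maxDomain q := ⟨v, hv.mem_maxDomain htop hbot⟩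
    set Λ : maxDomain q →ₗ[ℂ] ℂ := boundaryFunctional a b c d ∘ₗ hw.boundaryMap with hΛ
    by_cases h0 : Λ u' = 0
    · refine ⟨u', fun hz => ?_, hu, h0⟩
      have : u 0 = 0 := congrFun (congrArg Subtype.val hz) 0
      rw [hu0] at this
      exact one_ne_zero this
    -- `Λ` kills this combination, and its derivative at `0` is `-Λ u' ≠ 0`, so it is not zero.
    · refine ⟨Λ v' • u' + (-Λ u') • v', fun hz => h0 ?_, (hu.smul _).add (hv.smul _), ?_⟩
      · have hz' : (Λ v' • u + (-Λ u') • v : ℝ → ℂ) = fun _ => 0 := congrArg Subtype.val hz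
        have hd := (((hu.1.differentiable 0).hasDerivAt.const_smul (Λ v')).add
          ((hv.1.differentiable 0).hasDerivAt.const_smul (-Λ u'))).deriv
        rw [hz', deriv_const, hu1, hv1] at hd
        simpa using hd
      · change Λ _ = 0
        rw [map_add, map_smul, map_smul, smul_eq_mul, smul_eq_mul]
        ring
  obtain ⟨y, hy0, hys, hyb⟩ := hex
  have hyT := (hdom y).2 hyb
  refine ⟨⟨toL2 q y, hyT⟩, fun hz => hy0 (toL2_injective q (hz.trans (map_zero _).symm)), ?_⟩
  rw [apply_eq_tauL2 hT]
  exact (MemLp.toLp_eq_toLp_iff y.2.2.2 (y.2.2.1.const_smul l)).2 hys.2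

end IsBoundaryPair

theorem resolventSet_eq_empty {T : L2 →ₗ.[ℂ] L2} (h : ∀ l, IsEigenvalue T l) :
    resolventSet T = ∅ := by
  refine eq_empty_of_forall_notMem fun l ⟨R, _, hR⟩ => ?_
  obtain ⟨f, hf0, hf⟩ := h l
  have := hR f
  rw [hf, sub_self, map_zero] at this
  exact hf0 this.symm

/-! ### `PT` symmetry of the condition `α₁ = β₁`. -/

section PT

variable {q : ℝ → ℝ}

theorem memLp_conj_comp_neg {f : ℝ → ℂ} (hf : MemLp f 2 volume) :
    MemLp (fun x => conj (f (-x))) 2 volume :=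
  (hf.comp_measurePreserving (Measure.measurePreserving_neg (volume : Measure ℝ))).star

theorem parity_timeReversal_toLp {f : ℝ → ℂ} (hf : MemLp f 2 volume) :
    parity (timeReversal (hf.toLp f)) = (memLp_conj_comp_neg hf).toLp _ := by
  refine Lp.ext ?_
  have hmp := Measure.measurePreserving_neg (volume : Measure ℝ)
  filter_upwards [Lp.coeFn_compMeasurePreserving (timeReversal (hf.toLp f)) hmp,
    (memLp_conj_comp_neg hf).coeFn_toLp, hmp.quasiMeasurePreserving.ae (Lp.coeFn_star (hf.toLp f)),
    hmp.quasiMeasurePreserving.ae hf.coeFn_toLp] with x h1 h2 h3 h4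
  rw [h2]
  refine h1.trans (h3.trans ?_)
  rw [Pi.star_apply, h4]
  rfl

theorem tau_conj_comp_neg (heven : ∀ x, q (-x) = q x) (y : ℝ → ℂ) (x : ℝ) :
    tau q (fun x => conj (y (-x))) x = conj (tau q y (-x)) := by
  rw [tau_conj q fun x => y (-x), tau_comp_neg heven]

/-- The action of `PT` on the maximal domain. -/
def conjNeg (heven : ∀ x, q (-x) = q x) (y : maxDomain q) : maxDomain q :=
  ⟨fun x => conj ((y : ℝ → ℂ) (-x)), y.2.1.comp_neg.conj, memLp_conj_comp_neg y.2.2.1, by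
    rw [funext (tau_conj_comp_neg heven y)]
    exact memLp_conj_comp_neg y.2.2.2⟩

theorem toL2_conjNeg (heven : ∀ x, q (-x) = q x) (y : maxDomain q) :
    toL2 q (conjNeg heven y) = parity (timeReversal (toL2 q y)) :=
  (parity_timeReversal_toLp y.2.2.1).symm

theorem tauL2_conjNeg (heven : ∀ x, q (-x) = q x) (y : maxDomain q) :
    tauL2 q (conjNeg heven y) = parity (timeReversal (tauL2 q y)) := by
  refine Eq.trans ?_ (parity_timeReversal_toLp y.2.2.2).symm
  exact (MemLp.toLp_eq_toLp_iff (conjNeg heven y).2.2.2 (memLp_conj_comp_neg y.2.2.2)).2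
    (ae_of_all _ (tau_conj_comp_neg heven y))

theorem deriv_conj_comp_neg (f : ℝ → ℂ) (x : ℝ) :
    deriv (fun x => conj (f (-x))) x = -conj (deriv f (-x)) := by
  rw [deriv_conj fun x => f (-x), deriv_comp_neg_eq]
  exact map_neg _ _

/-- The sign from differentiating a reflection is absorbed by the oddness of `w₁`; the even `w₂`
would produce a minus sign. -/
theorem IsBoundaryPair.bracket_conjNeg {w₁ w₂ : ℝ → ℂ} (hw : IsBoundaryPair q w₁ w₂)
    (f : ℝ → ℂ) (x : ℝ) : bracket w₁ (fun x => conj (f (-x))) x = conj (bracket w₁ f (-x)) := by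
  have hd : deriv w₁ (-x) = deriv w₁ x := by
    have h : (fun x => w₁ (-x)) = fun x => -w₁ x := funext hw.odd₁
    have := congrFun (deriv_comp_neg_eq w₁) x
    rw [h, deriv.fun_neg] at this
    exact (neg_injective this).symm
  rw [bracket_of_real hw.real₁, bracket_of_real hw.real₁, deriv_conj_comp_neg, hd, hw.odd₁,
    map_sub, map_mul, map_mul, map_neg, Complex.conj_eq_iff_im.2 (hw.real₁ x),
    conj_deriv_of_real hw.real₁]
  ring

theorem IsBoundaryPair.bracketBot_conjNeg {w₁ w₂ : ℝ → ℂ} (hw : IsBoundaryPair q w₁ w₂)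
    (heven : ∀ x, q (-x) = q x) (y : maxDomain q) :
    bracketBot w₁ (conjNeg heven y) = conj (bracketTop w₁ y) := by
  refine tendsto_nhds_unique (tendsto_bracketBot ⟨w₁, hw.mem₁⟩ (conjNeg heven y)) ?_
  exact (((Complex.continuous_conj.tendsto _).comp (tendsto_bracketTop ⟨w₁, hw.mem₁⟩ y)).comp
    tendsto_neg_atBot_atTop).congr fun x => (hw.bracket_conjNeg y x).symm

theorem IsBoundaryPair.bracketTop_conjNeg {w₁ w₂ : ℝ → ℂ} (hw : IsBoundaryPair q w₁ w₂)
    (heven : ∀ x, q (-x) = q x) (y : maxDomain q) :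
    bracketTop w₁ (conjNeg heven y) = conj (bracketBot w₁ y) := by
  refine tendsto_nhds_unique (tendsto_bracketTop ⟨w₁, hw.mem₁⟩ (conjNeg heven y)) ?_
  exact (((Complex.continuous_conj.tendsto _).comp (tendsto_bracketBot ⟨w₁, hw.mem₁⟩ y)).comp
    tendsto_neg_atTop_atBot).congr fun x => (hw.bracket_conjNeg y x).symm

/-- The restriction of `A_max` to `{f : α₁(f) = β₁(f)}`. -/
def IsBoundaryPair.periodicOp {w₁ w₂ : ℝ → ℂ} (hw : IsBoundaryPair q w₁ w₂) : L2 →ₗ.[ℂ] L2 :=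
  (maxOp q).domRestrict
    ((LinearMap.ker (boundaryFunctional 1 0 1 0 ∘ₗ hw.boundaryMap)).map (toL2 q))

theorem IsBoundaryPair.hasBoundaryCondition_periodicOp {w₁ w₂ : ℝ → ℂ}
    (hw : IsBoundaryPair q w₁ w₂) : HasBoundaryCondition q w₁ w₂ 1 0 1 0 hw.periodicOp := by
  refine hw.hasBoundaryCondition_iff.2 ⟨LinearPMap.domRestrict_le, fun y => ⟨?_, fun h => ?_⟩⟩
  · rintro ⟨⟨z, hz, hzy⟩, -⟩
    exact toL2_injective q hzy ▸ hz
  · exact ⟨⟨y, h, rfl⟩, y, rfl⟩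

/-- `PT` commutes with `τ_q` because `q` is real and even, and it turns `α₁ = β₁` into the conjugate
of the same equation. -/
theorem IsBoundaryPair.isPTSymmetric_periodicOp {w₁ w₂ : ℝ → ℂ} (hw : IsBoundaryPair q w₁ w₂)
    (heven : ∀ x, q (-x) = q x) : IsPTSymmetric hw.periodicOp := by
  have h := hw.hasBoundaryCondition_periodicOp
  refine ⟨hw.isClosed_of_hasBoundaryCondition h,
    (dense_minOp_domain hw).mono (hw.minOp_le_of_hasBoundaryCondition h).1, ?_⟩
  rintro ⟨f, hf⟩
  obtain ⟨y, rfl, hy⟩ := (h.2 f).1 hf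
  have hPT : toL2 q (conjNeg heven y) ∈ hw.periodicOp.domain := by
    refine (h.2 _).2 ⟨_, rfl, ?_⟩
    rw [hw.bracketBot_conjNeg, hw.bracketTop_conjNeg]
    simp only [one_mul, zero_mul, add_zero] at hy ⊢
    rw [hy]
  have e1 := apply_eq_tauL2 h.1 y hf
  have e2 := apply_eq_tauL2 h.1 _ hPT
  rw [tauL2_conjNeg] at e2
  refine ⟨toL2_conjNeg heven y ▸ hPT, ?_⟩
  rw [e1, ← e2]
  congr 2

end PT

end SturmLiouville

end

theorem mainTheorem1 (q : ℝ → ℝ) (hq : LocallyIntegrable q volume)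
    (heven : ∀ x, q (-x) = q x)
    (htop : SturmLiouville.LimitCircleAtTop q) (hbot : SturmLiouville.LimitCircleAtBot q) :
    (∃ w₁ w₂ : ℝ → ℂ, SturmLiouville.IsBoundaryPair q w₁ w₂) ∧
    (∀ w₁ w₂ : ℝ → ℂ, SturmLiouville.IsBoundaryPair q w₁ w₂ →
      ∀ T : SturmLiouville.L2 →ₗ.[ℂ] SturmLiouville.L2,
        (SturmLiouville.IsBiExtension (SturmLiouville.minOp q) T 3 ↔
          ∃ a b c d : ℂ, ¬(a = 0 ∧ b = 0 ∧ c = 0 ∧ d = 0) ∧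
            SturmLiouville.HasBoundaryCondition q w₁ w₂ a b c d T) ∧
        (SturmLiouville.IsBiExtension (SturmLiouville.minOp q) T 3 →
          (∀ l : ℂ, l.im ≠ 0 → SturmLiouville.IsEigenvalue T l) ∧
          SturmLiouville.spectrumOf T = Set.univ)) ∧
    (∃ T : SturmLiouville.L2 →ₗ.[ℂ] SturmLiouville.L2,
      SturmLiouville.IsBiExtension (SturmLiouville.minOp q) T 3 ∧
      SturmLiouville.IsPTSymmetric T ∧ SturmLiouville.resolventSet T = ∅) := by
  have hpair := SturmLiouville.exists_isBoundaryPair hq heven htop hbot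
  refine ⟨hpair, fun w₁ w₂ hw T => ⟨hw.isBiExtension_iff, fun hT => ?_⟩, ?_⟩
  · obtain ⟨a, b, c, d, -, hbc⟩ := hw.isBiExtension_iff.1 hT
    have heig := hw.isEigenvalue_of_hasBoundaryCondition hq htop hbot hbc
    refine ⟨fun l _ => heig l, ?_⟩
    rw [SturmLiouville.spectrumOf, SturmLiouville.resolventSet_eq_empty heig, Set.compl_empty]
  · obtain ⟨w₁, w₂, hw⟩ := hpair
    have hbc := hw.hasBoundaryCondition_periodicOp
    exact ⟨hw.periodicOp, hw.isBiExtension_iff.2 ⟨1, 0, 1, 0, by simp, hbc⟩,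
      hw.isPTSymmetric_periodicOp heven, SturmLiouville.resolventSet_eq_empty
        (hw.isEigenvalue_of_hasBoundaryCondition hq htop hbot hbc)⟩
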